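/- Let $d\in\{2,3\}$, $k\ge 0$, and let $T\subset\mathbb R^d$ be a convex polygon ($d=2$) or polyhedron ($d=3$) with nonempty interior, of diameter $h_T$, whose edges/faces are exactly the $n+1$ sets $e,e_1,\dots,e_n$. Let $b$ be the barycenter of $e$, and let $\alpha_i\in[0,\pi]$ be the angle between the outward normals of $e$ and $e_i$ (so the interior angle between $e$ and $e_i$ is $\pi-\alpha_i$). Call $e_i$ a neighbor of $e$ if they share a vertex ($d=2$), respectively an edge ($d=3$). Suppose that there is $\alpha_0>0$ with $\sin\alpha_0\ge\sqrt d/8$ such that 1. $\alpha_i\ge\alpha_0$ for all $i=1,\dots,n$, and $\alpha_i\le\pi-\alpha_0$ for every neighbor $e_i$ of $e$; 2. $2\,\mathrm{dist}(b,e\cap e_i)\ge h_T/4$ for every neighbor $e_i$ of $e$. For a set $K$ let $P_k(K)$ be the space of restrictions to $K$ of real polynomials of degree at most $k$ on $\mathbb R^d$ ($P_{-1}(K)=\{0\}$), let $\|\cdot\|_T$ be the norm of $L^2(T)$ and $\|\cdot\|_e$ the norm of $L^2(e)$ for the surface measure $ds$. Then for each $i$ there is a unique $\lambda_i\in P_1(T)$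 that vanishes on $e_i$ and has $\lambda_i(b)=1$, and for every $q_0\in P_k(e)$ there is a unique $q\in P_{k+n}(T)$ of the form $q=\lambda_1\cdots\lambda_n q_1$ with $q_1\in P_k(T)$ such that $$\int_e (q-q_0)\,p\,ds=0\quad\forall p\in P_k(e),\qquad \int_T q\,p\,dx=0\quad\forall p\in P_{k-1}(T).$$ This $q$ satisfies $\|q\|_T\le C\,h_T^{1/2}\,\|q_0\|_e$, where $$C=\frac{2^{10k+4n+1/2}}{\sin^n\alpha_0}\left(\Big(\frac{2^{4n+12k-5}}{\sin^n\alpha_0}\Big)^2+1\right)^{1/2}$$ depends only on $k$, $n$ and $\alpha_0$. -/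

import Mathlib

open MeasureTheory

/-- A full-dimensional convex polytope in `ℝ^d` with exactly `n + 1` facets (edges if `d = 2`,
faces if `d = 3`), given as a bounded intersection of half-spaces `⟪ν i, x⟫ ≤ c i` in which no
half-space is redundant: each one cuts out a set of dimension `d - 1` in the boundary, and
different indices belong to different facets. -/
structure ConvexPolytope (d n : ℕ) where
  /-- outward unit normals of the facets -/
  normal : Fin (n + 1) → EuclideanSpace ℝ (Fin d)
  /-- offsets of the supporting hyperplanes -/
  offset : Fin (n + 1) → ℝ
  norm_normal : ∀ i, ‖normal i‖ = 1
  normal_injective : Function.Injective normal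
  bounded : Bornology.IsBounded {x | ∀ j, inner ℝ (normal j) x ≤ offset j}
  interior_nonempty : (interior {x | ∀ j, inner ℝ (normal j) x ≤ offset j}).Nonempty
  facet_nonempty : ∀ i,
    {x | (∀ j, inner ℝ (normal j) x ≤ offset j) ∧ inner ℝ (normal i) x = offset i}.Nonempty
  facet_dim : ∀ i, Module.finrank ℝ (vectorSpan ℝ
    {x | (∀ j, inner ℝ (normal j) x ≤ offset j) ∧ inner ℝ (normal i) x = offset i}) + 1 = d

namespace ConvexPolytope

variable {d n : ℕ}

/-- The polytope `T` as a (closed) set. -/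
def carrier (T : ConvexPolytope d n) : Set (EuclideanSpace ℝ (Fin d)) :=
  {x | ∀ j, inner ℝ (T.normal j) x ≤ T.offset j}

/-- The facets. Index `0` is the distinguished facet `e`, index `i.succ` is `e_i`. -/
def facet (T : ConvexPolytope d n) (i : Fin (n + 1)) : Set (EuclideanSpace ℝ (Fin d)) :=
  {x | x ∈ T.carrier ∧ inner ℝ (T.normal i) x = T.offset i}

/-- The size `h_T`: the diameter. -/
noncomputable def size (T : ConvexPolytope d n) : ℝ := Metric.diam T.carrier

/-- The surface measure (length if `d = 2`, area if `d = 3`) on the facet `e`. -/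
noncomputable def surface (T : ConvexPolytope d n) : Measure (EuclideanSpace ℝ (Fin d)) :=
  (Measure.euclideanHausdorffMeasure (d - 1)).restrict (T.facet 0)

/-- Lebesgue measure on `T`. -/
noncomputable def bulk (T : ConvexPolytope d n) : Measure (EuclideanSpace ℝ (Fin d)) :=
  volume.restrict T.carrier

/-- The barycenter of the facet `e`. -/
noncomputable def barycenter (T : ConvexPolytope d n) : EuclideanSpace ℝ (Fin d) :=
  ⨍ x, x ∂T.surface

/-- The angle `α_i` between the outward normals of `e` and `e_i`; the interior angle of `T`
between `e` and `e_i` is `π - α_i`. -/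
noncomputable def normalAngle (T : ConvexPolytope d n) (i : Fin n) : ℝ :=
  InnerProductGeometry.angle (T.normal 0) (T.normal i.succ)

/-- `e_i` is a neighbor of `e`: they share a face of dimension `d - 2`
(a vertex if `d = 2`, an edge if `d = 3`). -/
def IsNeighbor (T : ConvexPolytope d n) (i : Fin n) : Prop :=
  (T.facet 0 ∩ T.facet i.succ).Nonempty ∧
    Module.finrank ℝ (vectorSpan ℝ (T.facet 0 ∩ T.facet i.succ)) + 2 = d

end ConvexPolytope

/-- The value of a polynomial in `d` variables at a point of `ℝ^d`. -/
noncomputable def polyVal {d : ℕ} (p : MvPolynomial (Fin d) ℝ) (x : EuclideanSpace ℝ (Fin d)) :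
    ℝ :=
  MvPolynomial.eval (fun i => x i) p

/-- The `L²` inner product of two polynomials with respect to a measure. -/
noncomputable def l2Inner {d : ℕ} (μ : Measure (EuclideanSpace ℝ (Fin d)))
    (p r : MvPolynomial (Fin d) ℝ) : ℝ :=
  ∫ x, polyVal p x * polyVal r x ∂μ

/-- The `L²` norm of a polynomial with respect to a measure. -/
noncomputable def l2Norm {d : ℕ} (μ : Measure (EuclideanSpace ℝ (Fin d)))
    (p : MvPolynomial (Fin d) ℝ) : ℝ :=
  Real.sqrt (l2Inner μ p p)

namespace ConvexPolytope

variable {d n : ℕ}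

/-- `l = λ_i`: a polynomial of degree at most one that vanishes on `e_i` and takes the value `1`
at the barycenter of `e`. -/
def IsFaceFactor (T : ConvexPolytope d n) (i : Fin n) (l : MvPolynomial (Fin d) ℝ) : Prop :=
  l.totalDegree ≤ 1 ∧ (∀ x ∈ T.facet i.succ, polyVal l x = 0) ∧ polyVal l T.barycenter = 1

/-- `q = λ_1 ⋯ λ_n q_1 ∈ P_{k+n}(T)` with `q_1 ∈ P_k(T)`, such that `q - q_0` is orthogonal to
`P_k(e)` on `e` and `q` is orthogonal to `P_{k-1}(T)` on `T`. The functions in `P_k(e)` are the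
restrictions to `e` of polynomials of degree at most `k` on `ℝ^d`; `P_{-1}(T)` is zero. -/
def IsLift (T : ConvexPolytope d n) (k : ℕ) (lam : Fin n → MvPolynomial (Fin d) ℝ)
    (q₀ q : MvPolynomial (Fin d) ℝ) : Prop :=
  q.totalDegree ≤ k + n ∧
    (∃ q₁ : MvPolynomial (Fin d) ℝ, q₁.totalDegree ≤ k ∧ q = (∏ i, lam i) * q₁) ∧
    (∀ p : MvPolynomial (Fin d) ℝ, p.totalDegree ≤ k → l2Inner T.surface (q - q₀) p = 0) ∧
    (∀ p : MvPolynomial (Fin d) ℝ, p.totalDegree + 1 ≤ k → l2Inner T.bulk q p = 0)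

end ConvexPolytope

/-- The constant of the norm bound. -/
noncomputable def liftConst (k n : ℕ) (α₀ : ℝ) : ℝ :=
  (2 : ℝ) ^ (10 * (k : ℝ) + 4 * (n : ℝ) + 1 / 2) / Real.sin α₀ ^ n *
    Real.sqrt (((2 : ℝ) ^ (4 * (n : ℝ) + 12 * (k : ℝ) - 5) / Real.sin α₀ ^ n) ^ 2 + 1)

/-! The factors are `λ_i = gap_i / gap_i(b)`, where `gap_i` is the signed distance to the hyperplane
of `e_i`. Their product `w` (`weight`) is nonnegative on `T`, so pairings of `q = w q₁` with
polynomials are weighted `L²` pairings of `q₁`. Let `y` be the distance to the hyperplane of `e`,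
and split `q₁ = g + y u`, where `g` is the composition of `q₁` with the orthogonal projection onto
that hyperplane and `u` has degree at most `k - 1` (`exists_polyVal_eq_proj_add`). The condition on
`e` sees only `g`; given `g`, the condition on `T` is a linear problem for `u` with the form `∫ y w
u p`. Both forms are semidefinite and control the unweighted `L²` norms on `e` and `T`, which gives
existence (`exists_lift_factor`).

For the bound, testing on `e` with `q₁` controls `∫_e w q₁²` by `‖q₀‖_e²`. The integral of `g²` over
`T` is at most `h_T` times an integral of `q₁²` over a disc of radius `h_T` in the hyperplane of `e`
(`setIntegral_proj_le`), and this returns to `∫_e w q₁²` (`integral_sq_ball_le`). Testing on `T`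
with `u` controls `w y u` by `g` (`integral_sq_correction_le`). Uniqueness is the same bound for
data `0`.

Two ingredients supply the constants. Geometrically, `e` contains the disc of radius `h_T / 8` about
`b` (`ball_subset_footprint`), and this with the angle condition gives `λ_i ≤ 9 / sin α₀` on `T`
(`gap_le_of_mem_carrier`). Analytically, a polynomial on a set is controlled by its values on
dilates of the set toward a center (`setIntegral_sq_le_of_dilation`): along each ray it is
extrapolated from `k + 1` nodes close to the center, where the weights are bounded below because the
gaps are affine. -/

/-! ### Extrapolation of univariate polynomials from equidistant nodes. -/

/-- The denominator of a Lagrange basis polynomial at the nodes `1, …, N`. The nodes below and above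
`j + 1` contribute one factorial each. -/
theorem prod_erase_range_abs_sub (N j : ℕ) (hj : j < N) :
    ∏ i ∈ (Finset.range N).erase j, |((j : ℝ) + 1) - ((i : ℝ) + 1)|
      = (j.factorial : ℝ) * ((N - 1 - j).factorial : ℝ) := by
  have h1 : (Finset.range N).erase j = Finset.range j ∪ Finset.Ico (j + 1) N := by
    ext i; simp only [Finset.mem_erase, Finset.mem_range, Finset.mem_union, Finset.mem_Ico]; omega
  rw [h1, Finset.prod_union]
  · congr 1
    · rw [← Finset.prod_range_reflect, ← Finset.prod_range_add_one_eq_factorial]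
      push_cast
      refine Finset.prod_congr rfl fun i hi => ?_
      have hi' : i < j := Finset.mem_range.1 hi
      rw [Nat.sub_sub, Nat.cast_sub (by omega)]
      push_cast
      rw [abs_of_nonneg (by ring_nf; positivity)]
      ring
    · rw [Finset.prod_Ico_eq_prod_range, ← Finset.prod_range_add_one_eq_factorial]
      push_cast
      rw [show N - (j + 1) = N - 1 - j by omega]
      refine Finset.prod_congr rfl fun i hi => ?_
      rw [abs_of_nonpos (by ring_nf; linarith [(Nat.cast_nonneg i : (0 : ℝ) ≤ i)])]
      ring
  · rw [Finset.disjoint_left]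
    intro i; simp only [Finset.mem_range, Finset.mem_Ico]; omega

/-- The full node polynomial at the evaluation point; a Lagrange numerator is this with one factor
removed. -/
theorem prod_range_sub_eq_choose (A N : ℕ) (hA : N ≤ A) :
    ∏ i ∈ Finset.range N, ((A : ℝ) + 1 - ((i : ℝ) + 1)) = (N.factorial : ℝ) * (A.choose N : ℝ) := by
  rw [← Nat.cast_mul, ← Nat.descFactorial_eq_factorial_mul_choose, Nat.descFactorial_eq_prod_range]
  push_cast
  refine Finset.prod_congr rfl fun i hi => ?_
  have := Finset.mem_range.1 hi
  rw [Nat.cast_sub (by omega)]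
  ring

/-- Extrapolation from the nodes `1, …, k + 1` to `M (k + 1)` with explicit control of the
coefficients. -/
theorem exists_extrapolation (k M : ℕ) (hM : 2 ≤ M) :
    ∃ c : ℕ → ℝ, (∀ P : Polynomial ℝ, P.natDegree ≤ k →
        P.eval ((M : ℝ) * (k + 1)) = ∑ j ∈ Finset.range (k + 1), c j * P.eval ((j : ℝ) + 1)) ∧
      ∑ j ∈ Finset.range (k + 1), |c j| * (((k : ℝ) + 1) / (j + 1)) ≤
        (2 ^ (k + 1) - 1) * ((M * (k + 1) - 1).choose (k + 1) : ℝ) / (M - 1) := by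
  classical
  set N := k + 1 with hN
  set v : ℕ → ℝ := fun i => (i : ℝ) + 1 with hv
  have hinj : Set.InjOn v (Finset.range N) := by
    intro a _ b _ hab
    simpa [hv] using hab
  have hMN : N + N ≤ M * N := by nlinarith
  refine ⟨fun j => (Lagrange.basis (Finset.range N) v j).eval ((M : ℝ) * (k + 1)), ?_, ?_⟩
  · intro P hP
    have hdeg : P.degree < (Finset.range N).card := by
      rw [Finset.card_range]
      exact lt_of_le_of_lt Polynomial.degree_le_natDegree (by exact_mod_cast (by omega))
    conv_lhs => rw [Lagrange.eq_interpolate hinj hdeg]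
    rw [Lagrange.interpolate_apply, Polynomial.eval_finsetSum]
    refine Finset.sum_congr rfl fun j _ => ?_
    simp [hv, mul_comm]
  · have hM1 : (0 : ℝ) < (M : ℝ) - 1 := by
      have : (2 : ℝ) ≤ M := by exact_mod_cast hM
      linarith
    -- The factor `M N - (j + 1)` missing from the numerator is at least `(M - 1) N`, and this `N`
    -- cancels the one in the weight `N / (j + 1)`. What remains is `N.choose (j + 1)`, with sum `2
    -- ^ N - 1`.
    have key : ∀ j ∈ Finset.range N,
        |(Lagrange.basis (Finset.range N) v j).eval ((M : ℝ) * (k + 1))| *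
          (((k : ℝ) + 1) / (j + 1)) ≤
        (N.choose (j + 1) : ℝ) * ((M * N - 1).choose N : ℝ) / (M - 1) := by
      intro j hj
      have hjN : j < N := Finset.mem_range.1 hj
      have hx : ((M : ℝ) * (k + 1)) = ((M * N - 1 : ℕ) : ℝ) + 1 := by
        rw [Nat.cast_sub (by omega), hN]; push_cast; ring
      have e1 : |(Lagrange.basis (Finset.range N) v j).eval ((M : ℝ) * (k + 1))| *
          (j.factorial * (N - 1 - j).factorial : ℝ) * ((M : ℝ) * N - (j + 1)) =
          (N.factorial : ℝ) * ((M * N - 1).choose N : ℝ) := by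
        rw [Lagrange.basis, Polynomial.eval_prod, Finset.abs_prod]
        rw [← prod_erase_range_abs_sub N j hjN, ← Finset.prod_mul_distrib]
        rw [← prod_range_sub_eq_choose (M * N - 1) N (by omega), ← hx,
          ← Finset.prod_erase_mul _ _ hj]
        congr 1
        · refine Finset.prod_congr rfl fun i hi => ?_
          have hij : i ≠ j := (Finset.mem_erase.1 hi).1
          have hiN : i < N := Finset.mem_range.1 (Finset.mem_erase.1 hi).2
          have hne : ((j : ℝ) + 1) - ((i : ℝ) + 1) ≠ 0 := by
            intro h
            apply hij
            have : (i : ℝ) = j := by linarith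
            exact_mod_cast this
          simp only [Lagrange.basisDivisor, Polynomial.eval_mul, Polynomial.eval_C,
            Polynomial.eval_sub, Polynomial.eval_X, hv, abs_mul, abs_inv]
          rw [mul_comm (|_|⁻¹), mul_assoc, inv_mul_cancel₀ (abs_ne_zero.2 hne), mul_one,
            abs_of_nonneg]
          have : ((i : ℝ) + 1) ≤ M * N := by exact_mod_cast (by omega : i + 1 ≤ M * N)
          rw [hN] at this; push_cast at this; linarith
        · rw [hN]; push_cast; ring
      have hf1 : (0 : ℝ) < (j.factorial : ℝ) := by exact_mod_cast Nat.factorial_pos j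
      have hf2 : (0 : ℝ) < ((N - 1 - j).factorial : ℝ) := by exact_mod_cast Nat.factorial_pos _
      have hden : ((M : ℝ) - 1) * N ≤ (M : ℝ) * N - (j + 1) := by
        have : (j : ℝ) + 1 ≤ N := by exact_mod_cast hjN
        linarith
      have hNpos : (0 : ℝ) < N := by exact_mod_cast (by omega : 0 < N)
      have hden0 : (0 : ℝ) < (M : ℝ) * N - (j + 1) := lt_of_lt_of_le (by positivity) hden
      have hfac : (N.choose (j + 1) : ℝ) * ((j + 1 : ℝ) * j.factorial) * (N - 1 - j).factorial
          = N.factorial := by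
        have := Nat.choose_mul_factorial_mul_factorial (n := N) (k := j + 1) hjN
        rw [Nat.factorial_succ, show N - (j + 1) = N - 1 - j by omega] at this
        exact_mod_cast this
      set a := |(Lagrange.basis (Finset.range N) v j).eval ((M : ℝ) * (k + 1))|
      have ha : 0 ≤ a := abs_nonneg _
      have hk : (k : ℝ) + 1 = N := by rw [hN]; push_cast; ring
      have e2 : a * ((M : ℝ) * N - (j + 1)) =
          (N.choose (j + 1) : ℝ) * (j + 1 : ℝ) * ((M * N - 1).choose N : ℝ) := by
        have : (j.factorial : ℝ) * (N - 1 - j).factorial ≠ 0 := by positivity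
        apply mul_right_cancel₀ this
        linear_combination e1 - ((M * N - 1).choose N : ℝ) * hfac
      rw [hk, le_div_iff₀ hM1, mul_div_assoc', div_mul_eq_mul_div, div_le_iff₀ (by positivity)]
      calc a * N * ((M : ℝ) - 1) = a * (((M : ℝ) - 1) * N) := by ring
        _ ≤ a * ((M : ℝ) * N - (j + 1)) := by gcongr
        _ = _ := by rw [e2]; ring
    refine (Finset.sum_le_sum key).trans (le_of_eq ?_)
    rw [← Finset.sum_div, ← Finset.sum_mul]
    congr 2
    have := Nat.sum_range_choose N
    rw [Finset.sum_range_succ'] at this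
    simp only [Nat.choose_zero_right] at this
    have h2 : ((∑ i ∈ Finset.range N, N.choose (i + 1) : ℕ) : ℝ) + 1 = 2 ^ N := by
      exact_mod_cast this
    push_cast at h2
    linarith

/-- The constant of the comparison of `L²` norms of polynomials on nested sets. -/
noncomputable def dilationConst (k M : ℕ) : ℝ :=
  (2 ^ (k + 1) - 1) * ((M * (k + 1) - 1).choose (k + 1) : ℝ) / (M - 1)

theorem dilationConst_nonneg (k M : ℕ) (hM : 2 ≤ M) : 0 ≤ dilationConst k M := by
  have : (2 : ℝ) ≤ M := by exact_mod_cast hM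
  have h1 : (1 : ℝ) ≤ 2 ^ (k + 1) := one_le_pow₀ (by norm_num)
  exact div_nonneg (mul_nonneg (by linarith) (by positivity)) (by linarith)

/-! ### Comparison of `L²` norms of polynomials on a set and on its dilates. -/

section Dilation

variable {F : Type*} [NormedAddCommGroup F] [NormedSpace ℝ F] [MeasurableSpace F] [BorelSpace F]
  [FiniteDimensional ℝ F] (μ : Measure F) [μ.IsAddHaarMeasure]

theorem setIntegral_comp_dilation_le {a : F} {r : ℝ} (hr : 0 < r) {f : F → ℝ} (hf : Continuous f)
    (hf0 : ∀ x, 0 ≤ f x) {K K' : Set F} (hK : IsCompact K) (hK' : IsCompact K')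
    (h : ∀ x ∈ K, a + r • (x - a) ∈ K') :
    ∫ x in K, f (a + r • (x - a)) ∂μ ≤ (r ^ Module.finrank ℝ F)⁻¹ * ∫ x in K', f x ∂μ := by
  have hcont : Continuous fun x : F => a + r • (x - a) := by fun_prop
  have e : ∫ x, K'.indicator f (a + r • (x - a)) ∂μ
      = (r ^ Module.finrank ℝ F)⁻¹ * ∫ x in K', f x ∂μ := by
    have h1 := integral_sub_right_eq_self (μ := μ) (fun y => K'.indicator f (a + r • y)) a
    rw [h1, Measure.integral_comp_smul_of_nonneg μ (fun y => K'.indicator f (a + y)) r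
        (hR := hr.le),
      integral_add_left_eq_self (μ := μ) (fun y => K'.indicator f y) a,
      integral_indicator hK'.measurableSet, smul_eq_mul]
  rw [← e, ← integral_indicator hK.measurableSet]
  have hint : Integrable (K'.indicator f) μ :=
    (hf.continuousOn.integrableOn_compact hK').integrable_indicator hK'.measurableSet
  refine integral_mono ?_ ?_ ?_
  · exact ((hf.comp hcont).continuousOn.integrableOn_compact hK).integrable_indicator
      hK.measurableSet
  · have h2 : Integrable (fun y => K'.indicator f (a + y)) μ := hint.comp_add_left a
    have h3 := h2.comp_smul hr.ne'
    exact h3.comp_sub_right a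
  · intro x
    by_cases hx : x ∈ K
    · simp only [Set.indicator_of_mem hx, Set.indicator_of_mem (h x hx)]; exact le_rfl
    · rw [Set.indicator_of_notMem hx]
      exact Set.indicator_nonneg (fun y _ => hf0 y) _

/-- A function that is a polynomial of degree at most `k` on every line through `a` is controlled
in `L²(K)` by its `L²` norm on any set containing the dilates of `K` with center `a` and ratio at
most `1 / M`. -/
theorem setIntegral_sq_le_of_dilation (k M : ℕ) (hM : 2 ≤ M) (a : F) {f : F → ℝ}
    (hf : Continuous f)
    (hpoly : ∀ x, ∃ P : Polynomial ℝ, P.natDegree ≤ k ∧ ∀ t, P.eval t = f (a + t • (x - a)))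
    {K K' : Set F} (hK : IsCompact K) (hK' : IsCompact K')
    (h : ∀ x ∈ K, ∀ r : ℝ, 0 < r → r ≤ 1 / M → a + r • (x - a) ∈ K') {c : ℝ}
    (hc : ∀ j < k + 1, (((k : ℝ) + 1) / ((j : ℝ) + 1)) ^ Module.finrank ℝ F ≤
      c * (((k : ℝ) + 1) / ((j : ℝ) + 1)) ^ 2) :
    ∫ x in K, f x ^ 2 ∂μ ≤
      (M : ℝ) ^ Module.finrank ℝ F * c * dilationConst k M ^ 2 * ∫ x in K', f x ^ 2 ∂μ := by
  obtain ⟨γ, hγ, hsum⟩ := exists_extrapolation k M hM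
  have hMpos : (0 : ℝ) < M := by exact_mod_cast (by omega : 0 < M)
  set m := Module.finrank ℝ F
  set ρ : ℕ → ℝ := fun j => ((k : ℝ) + 1) / (j + 1) with hρ
  have hρpos : ∀ j, 0 < ρ j := fun j => by simp only [hρ]; positivity
  -- The ratios are `(j + 1) / (M (k + 1))`: the nodes `1, …, k + 1`, rescaled so that the
  -- evaluation point `M (k + 1)` becomes `1`. None exceeds `1 / M`.
  set r : ℕ → ℝ := fun j => (M * ρ j)⁻¹ with hr
  have hrpos : ∀ j, 0 < r j := fun j => inv_pos.2 (mul_pos hMpos (hρpos j))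
  set B := ∫ x in K', f x ^ 2 ∂μ with hB
  have hB0 : 0 ≤ B := integral_nonneg fun x => sq_nonneg _
  set S := ∑ j ∈ Finset.range (k + 1), |γ j| * ρ j with hS
  have hS0 : 0 ≤ S := Finset.sum_nonneg fun j _ => mul_nonneg (abs_nonneg _) (hρpos j).le
  have hc0 : 0 ≤ c := by
    have := hc 0 (by omega)
    have h1 : 0 < (((k : ℝ) + 1) / (((0 : ℕ) : ℝ) + 1)) := by positivity
    by_contra hneg
    push Not at hneg
    have h2 : 0 < (((k : ℝ) + 1) / (((0 : ℕ) : ℝ) + 1)) ^ m := by positivity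
    nlinarith [sq_pos_of_pos h1]
  have hfx : ∀ x, f x = ∑ j ∈ Finset.range (k + 1), γ j * f (a + r j • (x - a)) := by
    intro x
    obtain ⟨P, hP, hPe⟩ := hpoly x
    have hk1 : ((M : ℝ) * (k + 1)) ≠ 0 := by positivity
    set Q := P.comp (Polynomial.C ((M : ℝ) * (k + 1))⁻¹ * Polynomial.X) with hQ
    have hQd : Q.natDegree ≤ k := by
      refine (Polynomial.natDegree_comp_le).trans ?_
      calc P.natDegree * _ ≤ P.natDegree * 1 :=
            Nat.mul_le_mul_left _ ((Polynomial.natDegree_C_mul_le _ _).trans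
            Polynomial.natDegree_X_le)
        _ ≤ k := by simpa using hP
    have hQe : ∀ t, Q.eval t = f (a + (((M : ℝ) * (k + 1))⁻¹ * t) • (x - a)) := by
      intro t; simp [hQ, Polynomial.eval_comp, hPe]
    have := hγ Q hQd
    rw [hQe, inv_mul_cancel₀ hk1, one_smul, add_sub_cancel] at this
    rw [this]
    refine Finset.sum_congr rfl fun j _ => ?_
    rw [hQe]
    congr 4
    simp only [hr, hρ]
    field_simp
  -- Cauchy–Schwarz with the weights `|γ j| ρ j` and `|γ j| / ρ j`. Substitution in dimension `m`
  -- costs `ρ j ^ m`, of which `ρ j ^ 2` restores the sum `S`; the excess `ρ j ^ (m - 2)` goes into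
  -- `c`.
  have hpt : ∀ x, f x ^ 2 ≤
      S * ∑ j ∈ Finset.range (k + 1), |γ j| * (ρ j)⁻¹ * f (a + r j • (x - a)) ^ 2 := by
    intro x
    rw [hfx x]
    have hcs := Finset.sum_mul_sq_le_sq_mul_sq (Finset.range (k + 1))
      (fun j => Real.sqrt (|γ j| * ρ j))
      (fun j => Real.sqrt (|γ j| * (ρ j)⁻¹) * |f (a + r j • (x - a))|)
    have e1 : ∀ j, Real.sqrt (|γ j| * ρ j) ^ 2 = |γ j| * ρ j := fun j =>
      Real.sq_sqrt (mul_nonneg (abs_nonneg _) (hρpos j).le)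
    have e2 : ∀ j, (Real.sqrt (|γ j| * (ρ j)⁻¹) * |f (a + r j • (x - a))|) ^ 2
        = |γ j| * (ρ j)⁻¹ * f (a + r j • (x - a)) ^ 2 := fun j => by
      rw [mul_pow, sq_abs, Real.sq_sqrt (mul_nonneg (abs_nonneg _) (inv_pos.2 (hρpos j)).le)]
    have e3 : ∀ j, Real.sqrt (|γ j| * ρ j) *
        (Real.sqrt (|γ j| * (ρ j)⁻¹) * |f (a + r j • (x - a))|) =
        |γ j * f (a + r j • (x - a))| := fun j => by
      rw [← mul_assoc, ← Real.sqrt_mul (mul_nonneg (abs_nonneg _) (hρpos j).le), abs_mul]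
      congr 1
      rw [show |γ j| * ρ j * (|γ j| * (ρ j)⁻¹) = |γ j| * |γ j| * (ρ j * (ρ j)⁻¹) by ring,
        mul_inv_cancel₀ (hρpos j).ne', mul_one, Real.sqrt_mul_self (abs_nonneg _)]
    simp only [e1, e2, e3] at hcs
    refine le_trans ?_ hcs
    rw [← sq_abs]
    gcongr
    exact Finset.abs_sum_le_sum_abs _ _
  have hci : ∀ j, Continuous fun x => f (a + r j • (x - a)) ^ 2 := fun j => by fun_prop
  have hint : ∀ j, IntegrableOn (fun x => f (a + r j • (x - a)) ^ 2) K μ := fun j =>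
    (hci j).continuousOn.integrableOn_compact hK
  calc ∫ x in K, f x ^ 2 ∂μ
      ≤ ∫ x in K, S * ∑ j ∈ Finset.range (k + 1),
          |γ j| * (ρ j)⁻¹ * f (a + r j • (x - a)) ^ 2 ∂μ := by
        refine setIntegral_mono ((hf.pow 2).continuousOn.integrableOn_compact hK) ?_ hpt
        exact (integrable_finsetSum _ fun j _ => (hint j).const_mul _).const_mul _
    _ = S * ∑ j ∈ Finset.range (k + 1),
          |γ j| * (ρ j)⁻¹ * ∫ x in K, f (a + r j • (x - a)) ^ 2 ∂μ := by
        rw [integral_const_mul, integral_finsetSum _ fun j _ => (hint j).const_mul _]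
        simp_rw [integral_const_mul]
    _ ≤ S * ∑ j ∈ Finset.range (k + 1), |γ j| * ρ j * ((M : ℝ) ^ m * c * B) := by
        refine mul_le_mul_of_nonneg_left (Finset.sum_le_sum fun j hj => ?_) hS0
        have hj' : j < k + 1 := Finset.mem_range.1 hj
        have h1 : ∫ x in K, f (a + r j • (x - a)) ^ 2 ∂μ ≤ (r j ^ m)⁻¹ * B := by
          refine setIntegral_comp_dilation_le μ (hrpos j) (f := fun x => f x ^ 2) (hf.pow 2)
            (fun x => sq_nonneg _) hK hK' fun x hx => h x hx _ (hrpos j) ?_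
          simp only [hr, one_div]
          gcongr
          have : 1 ≤ ρ j := by
            simp only [hρ]
            rw [one_le_div (by positivity)]
            have : (j : ℝ) ≤ k := by exact_mod_cast (by omega : j ≤ k)
            linarith
          nlinarith
        have h2 : (r j ^ m)⁻¹ ≤ (M : ℝ) ^ m * (c * ρ j ^ 2) := by
          simp only [hr]
          rw [← inv_pow, inv_inv, mul_pow]
          exact mul_le_mul_of_nonneg_left (hc j hj') (by positivity)
        calc |γ j| * (ρ j)⁻¹ * ∫ x in K, f (a + r j • (x - a)) ^ 2 ∂μ
            ≤ |γ j| * (ρ j)⁻¹ * ((M : ℝ) ^ m * (c * ρ j ^ 2) * B) := by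
              refine mul_le_mul_of_nonneg_left (h1.trans ?_)
                (mul_nonneg (abs_nonneg _) (inv_pos.2 (hρpos j)).le)
              exact mul_le_mul_of_nonneg_right h2 hB0
          _ = |γ j| * ((ρ j)⁻¹ * ρ j) * ρ j * ((M : ℝ) ^ m * c * B) := by ring
          _ = _ := by rw [inv_mul_cancel₀ (hρpos j).ne', mul_one]
    _ = S ^ 2 * ((M : ℝ) ^ m * c * B) := by rw [← Finset.sum_mul, ← hS]; ring
    _ ≤ dilationConst k M ^ 2 * ((M : ℝ) ^ m * c * B) := by
        have : S ≤ dilationConst k M := hsum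
        gcongr
    _ = _ := by ring

end Dilation

/-! ### Gaps, coordinates on the hyperplane of `e`, surface measure and barycenter. -/

namespace ConvexPolytope

variable {d n : ℕ}

/-- The signed distance of `x` to the hyperplane of the facet `i`, positive inside. -/
noncomputable def gap (T : ConvexPolytope d n) (i : Fin (n + 1)) (x : EuclideanSpace ℝ (Fin d)) :
    ℝ :=
  T.offset i - inner ℝ (T.normal i) x

/-- The direction of the hyperplane of the distinguished facet. -/
noncomputable abbrev tangent (T : ConvexPolytope d n) : Submodule ℝ (EuclideanSpace ℝ (Fin d)) :=
  (ℝ ∙ T.normal 0)ᗮ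

/-- The distinguished facet in the coordinates of its hyperplane with origin `p`. -/
def footprint (T : ConvexPolytope d n) (p : EuclideanSpace ℝ (Fin d)) : Set T.tangent :=
  {v | p + (v : EuclideanSpace ℝ (Fin d)) ∈ T.facet 0}

variable (T : ConvexPolytope d n)

theorem gap_nonneg {x : EuclideanSpace ℝ (Fin d)} (hx : x ∈ T.carrier) (i : Fin (n + 1)) :
    0 ≤ T.gap i x :=
  sub_nonneg.2 (hx i)

theorem mem_carrier_iff {x : EuclideanSpace ℝ (Fin d)} :
    x ∈ T.carrier ↔ ∀ i, 0 ≤ T.gap i x := by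
  simp [carrier, gap]

theorem mem_facet_iff {x : EuclideanSpace ℝ (Fin d)} {i : Fin (n + 1)} :
    x ∈ T.facet i ↔ x ∈ T.carrier ∧ T.gap i x = 0 := by
  simp only [facet, gap, Set.mem_ofPred_eq, sub_eq_zero]
  exact and_congr_right fun _ => eq_comm

theorem gap_add (i : Fin (n + 1)) (x v : EuclideanSpace ℝ (Fin d)) :
    T.gap i (x + v) = T.gap i x - inner ℝ (T.normal i) v := by
  simp only [gap, inner_add_right]; ring

theorem continuous_gap (i : Fin (n + 1)) : Continuous (T.gap i) := by
  unfold gap; fun_prop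

theorem gap_segment (i : Fin (n + 1)) (a x : EuclideanSpace ℝ (Fin d)) (t : ℝ) :
    T.gap i (a + t • (x - a)) = (1 - t) * T.gap i a + t * T.gap i x := by
  simp only [gap, inner_add_right, inner_smul_right, inner_sub_right]; ring

theorem isClosed_carrier : IsClosed T.carrier := by
  have : T.carrier = ⋂ i, {x | inner ℝ (T.normal i) x ≤ T.offset i} := by
    ext x; simp [carrier]
  rw [this]
  exact isClosed_iInter fun i => isClosed_le (by fun_prop) continuous_const

theorem isCompact_carrier : IsCompact T.carrier :=
  Metric.isCompact_of_isClosed_isBounded T.isClosed_carrier T.bounded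

theorem segment_mem_carrier {a x : EuclideanSpace ℝ (Fin d)} (ha : a ∈ T.carrier)
    (hx : x ∈ T.carrier) {t : ℝ} (h0 : 0 ≤ t) (h1 : t ≤ 1) : a + t • (x - a) ∈ T.carrier := by
  rw [mem_carrier_iff]
  intro i
  rw [gap_segment]
  exact add_nonneg (mul_nonneg (by linarith) (T.gap_nonneg ha i))
    (mul_nonneg h0 (T.gap_nonneg hx i))

theorem convex_carrier : Convex ℝ T.carrier := by
  intro x hx y hy a b ha hb hab
  have := T.segment_mem_carrier hx hy hb (by linarith)
  convert this using 1
  rw [show a = 1 - b by linarith]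
  module

theorem isClosed_facet (i : Fin (n + 1)) : IsClosed (T.facet i) :=
  T.isClosed_carrier.inter (isClosed_eq (by fun_prop) continuous_const)

theorem isCompact_facet (i : Fin (n + 1)) : IsCompact (T.facet i) :=
  T.isCompact_carrier.of_isClosed_subset (T.isClosed_facet i) fun _ hx => hx.1

theorem convex_facet (i : Fin (n + 1)) : Convex ℝ (T.facet i) := by
  refine T.convex_carrier.inter ?_
  exact convex_hyperplane (f := fun x => inner ℝ (T.normal i) x)
    ⟨fun x y => inner_add_right _ _ _, fun c x => inner_smul_right _ _ _⟩ _

theorem normal_ne_zero (i : Fin (n + 1)) : T.normal i ≠ 0 := by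
  intro h
  have := T.norm_normal i
  simp [h] at this

theorem inner_normal_self (i : Fin (n + 1)) : inner ℝ (T.normal i) (T.normal i) = 1 := by
  rw [real_inner_self_eq_norm_sq, T.norm_normal, one_pow]

theorem mem_tangent_iff {v : EuclideanSpace ℝ (Fin d)} :
    v ∈ T.tangent ↔ inner ℝ (T.normal 0) v = 0 :=
  Submodule.mem_orthogonal_singleton_iff_inner_right

theorem finrank_tangent : Module.finrank ℝ T.tangent = d - 1 := by
  have h := Submodule.finrank_add_finrank_orthogonal (ℝ ∙ T.normal 0)
  rw [finrank_span_singleton (T.normal_ne_zero 0), finrank_euclideanSpace_fin] at h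
  exact (Nat.sub_eq_of_eq_add' h.symm).symm

theorem gap_zero_add_tangent (x : EuclideanSpace ℝ (Fin d)) (v : T.tangent) :
    T.gap 0 (x + v) = T.gap 0 x := by
  rw [gap_add, T.mem_tangent_iff.1 v.2, sub_zero]

theorem isometry_add_tangent (p : EuclideanSpace ℝ (Fin d)) :
    Isometry fun v : T.tangent => p + (v : EuclideanSpace ℝ (Fin d)) :=
  Isometry.of_dist_eq fun v w => by simp [dist_eq_norm]

theorem isCompact_footprint (p : EuclideanSpace ℝ (Fin d)) : IsCompact (T.footprint p) :=
  (T.isometry_add_tangent p).isClosedEmbedding.isCompact_preimage (T.isCompact_facet 0)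

theorem convex_footprint (p : EuclideanSpace ℝ (Fin d)) : Convex ℝ (T.footprint p) := by
  intro x hx y hy a b ha hb hab
  have := T.convex_facet 0 hx hy ha hb hab
  show p + _ ∈ T.facet 0
  convert this using 1
  push_cast
  rw [show a = 1 - b by linarith]
  module

theorem facet_eq_image_footprint {p : EuclideanSpace ℝ (Fin d)} (hp : T.gap 0 p = 0) :
    T.facet 0 = (fun v : T.tangent => p + (v : EuclideanSpace ℝ (Fin d))) '' T.footprint p := by
  ext x
  constructor
  · intro hx
    refine ⟨⟨x - p, ?_⟩, ?_, ?_⟩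
    · rw [mem_tangent_iff]
      have h1 := (T.mem_facet_iff.1 hx).2
      simp only [gap] at h1 hp
      rw [inner_sub_right]; linarith
    · simpa [footprint] using hx
    · simp
  · rintro ⟨v, hv, rfl⟩
    exact hv

/-- Isometries preserve Hausdorff measure, and on the `(d - 1)`-dimensional space `T.tangent` the
normalized Hausdorff measure is Lebesgue measure. Surface integrals thus become Lebesgue integrals
over the footprint. -/
theorem surface_eq_map {p : EuclideanSpace ℝ (Fin d)} (hp : T.gap 0 p = 0) :
    T.surface = (volume.restrict (T.footprint p)).map
      (fun v : T.tangent => p + (v : EuclideanSpace ℝ (Fin d))) := by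
  have hiso := T.isometry_add_tangent p
  have h1 := hiso.map_euclideanHausdorffMeasure (d := d - 1)
  have h2 : (Measure.euclideanHausdorffMeasure (d - 1) : Measure T.tangent) = volume := by
    rw [← T.finrank_tangent]; exact InnerProductSpace.euclideanHausdorffMeasure_eq_volume
  rw [h2] at h1
  have hsub : T.facet 0 ⊆ Set.range (fun v : T.tangent => p + (v : EuclideanSpace ℝ (Fin d))) := by
    rw [T.facet_eq_image_footprint hp]; exact Set.image_subset_range _ _
  rw [surface, ← Measure.restrict_restrict_of_subset hsub, ← h1,
    Measure.restrict_map hiso.continuous.measurable (T.isClosed_facet 0).measurableSet]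
  rfl

theorem integral_surface {G : Type*} [NormedAddCommGroup G] [NormedSpace ℝ G]
    {p : EuclideanSpace ℝ (Fin d)} (hp : T.gap 0 p = 0) (f : EuclideanSpace ℝ (Fin d) → G) :
    ∫ x, f x ∂T.surface =
      ∫ v in T.footprint p, f (p + (v : EuclideanSpace ℝ (Fin d))) := by
  rw [T.surface_eq_map hp]
  exact (T.isometry_add_tangent p).isClosedEmbedding.measurableEmbedding.integral_map f

/-- By `facet_dim` the directions of `e` span the whole tangent space, and a convex set with full
affine hull has interior points. -/
theorem interior_footprint_nonempty {p : EuclideanSpace ℝ (Fin d)} (hp : p ∈ T.facet 0) :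
    (interior (T.footprint p)).Nonempty := by
  have hp0 := (T.mem_facet_iff.1 hp).2
  have hne : (T.footprint p).Nonempty := ⟨0, by simpa [footprint] using hp⟩
  rw [(T.convex_footprint p).interior_nonempty_iff_affineSpan_eq_top,
    AffineSubspace.affineSpan_eq_top_iff_vectorSpan_eq_top_of_nonempty ℝ T.tangent T.tangent hne]
  apply Submodule.eq_top_of_finrank_eq
  apply le_antisymm (Submodule.finrank_le _)
  have h1 := T.facet_dim 0
  have h2 : vectorSpan ℝ (T.facet 0) =
      (vectorSpan ℝ (T.footprint p)).map T.tangent.subtype := by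
    set f : T.tangent →ᵃ[ℝ] EuclideanSpace ℝ (Fin d) :=
      T.tangent.subtype.toAffineMap + AffineMap.const ℝ T.tangent p with hf
    have hlin : f.linear = T.tangent.subtype := by ext v; simp [hf]
    have himg : T.facet 0 = f '' T.footprint p := by
      rw [T.facet_eq_image_footprint hp0]
      exact Set.image_congr fun v _ => by simp [hf, add_comm]
    rw [himg, ← f.map_vectorSpan, hlin]
  have h3 : Module.finrank ℝ (vectorSpan ℝ (T.facet 0)) + 1 = d := h1
  rw [T.finrank_tangent, show d - 1 = Module.finrank ℝ (vectorSpan ℝ (T.facet 0)) by omega, h2]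
  exact Submodule.finrank_map_le _ _

/-- The mean over a small ball in the footprint lies in that ball, hence in the interior, and
averaging it with the rest of a convex set stays in the interior. -/
theorem barycenter_eq {p : EuclideanSpace ℝ (Fin d)} (hp : p ∈ T.facet 0) :
    ∃ v ∈ interior (T.footprint p), T.barycenter = p + (v : EuclideanSpace ℝ (Fin d)) := by
  have hp0 := (T.mem_facet_iff.1 hp).2
  obtain ⟨v₀, hv₀⟩ := T.interior_footprint_nonempty hp
  have hc := T.isCompact_footprint p
  set μ : Measure T.tangent := volume.restrict (T.footprint p) with hμ
  have hfin : volume (T.footprint p) ≠ ⊤ := hc.measure_lt_top.ne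
  have : IsFiniteMeasure μ := ⟨by rw [hμ, Measure.restrict_apply_univ]; exact hfin.lt_top⟩
  have hpos : volume (T.footprint p) ≠ 0 :=
    (Measure.measure_pos_of_nonempty_interior _ ⟨v₀, hv₀⟩).ne'
  have : NeZero μ := ⟨by rw [hμ]; simpa [Measure.restrict_eq_zero] using hpos⟩
  have hint : Integrable (fun v : T.tangent => v) μ :=
    continuous_id.continuousOn.integrableOn_compact hc
  refine ⟨⨍ v, v ∂μ, ?_, ?_⟩
  · obtain ⟨r, hr, hball⟩ := Metric.nhds_basis_closedBall.mem_iff.1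
      (isOpen_interior.mem_nhds hv₀)
    refine (T.convex_footprint p).average_mem_interior_of_set (t := Metric.closedBall v₀ r)
      ?_ (ae_restrict_mem hc.measurableSet) hint (hball ?_)
    · rw [hμ, Measure.restrict_apply Metric.isClosed_closedBall.measurableSet,
        Set.inter_eq_left.2 (hball.trans interior_subset)]
      exact (Metric.measure_closedBall_pos volume v₀ hr).ne'
    · refine (convex_closedBall v₀ r).set_average_mem Metric.isClosed_closedBall ?_ ?_ ?_ ?_
      · rw [hμ, Measure.restrict_apply Metric.isClosed_closedBall.measurableSet,
          Set.inter_eq_left.2 (hball.trans interior_subset)]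
        exact (Metric.measure_closedBall_pos volume v₀ hr).ne'
      · finiteness
      · exact ae_restrict_mem Metric.isClosed_closedBall.measurableSet
      · exact hint.integrableOn
  · rw [barycenter, average_eq, average_eq, T.integral_surface hp0]
    have hm : T.surface.real Set.univ = μ.real Set.univ := by
      rw [T.surface_eq_map hp0, Measure.real, Measure.real,
        Measure.map_apply (T.isometry_add_tangent p).continuous.measurable MeasurableSet.univ]
      rfl
    have hc0 : μ.real Set.univ ≠ 0 := by
      rw [hμ, Measure.real, Measure.restrict_apply_univ]
      exact (ENNReal.toReal_pos hpos hfin).ne'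
    have hint' : Integrable (fun v : T.tangent => (v : EuclideanSpace ℝ (Fin d))) μ :=
      continuous_subtype_val.continuousOn.integrableOn_compact hc
    rw [integral_add (integrable_const p) hint', integral_const, hm, smul_add, smul_smul,
      measureReal_def, ← measureReal_def, inv_mul_cancel₀ hc0, one_smul]
    congr 1
    have := T.tangent.subtypeL.integral_comp_comm hint
    simp only [Submodule.coe_smul]
    congr 1

end ConvexPolytope

/-! ### Geometry of `T`: the disc in `e` about the barycenter and the bound for the factors. -/

namespace ConvexPolytope

variable {d n : ℕ} (T : ConvexPolytope d n)

theorem barycenter_mem_facet : T.barycenter ∈ T.facet 0 := by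
  obtain ⟨p, hp⟩ : (T.facet 0).Nonempty := T.facet_nonempty 0
  obtain ⟨v, hv, h⟩ := T.barycenter_eq hp
  rw [h]
  exact interior_subset (s := T.footprint p) hv

theorem barycenter_mem_carrier : T.barycenter ∈ T.carrier := T.barycenter_mem_facet.1

theorem gap_zero_barycenter : T.gap 0 T.barycenter = 0 :=
  (T.mem_facet_iff.1 T.barycenter_mem_facet).2

theorem zero_mem_interior_footprint : (0 : T.tangent) ∈ interior (T.footprint T.barycenter) := by
  obtain ⟨v, hv, h⟩ := T.barycenter_eq T.barycenter_mem_facet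
  have : v = 0 := by
    ext1
    simpa using h
  rwa [this] at hv

theorem norm_sub_barycenter_le {x : EuclideanSpace ℝ (Fin d)} (hx : x ∈ T.carrier) :
    ‖x - T.barycenter‖ ≤ T.size := by
  rw [← dist_eq_norm]
  exact Metric.dist_le_diam_of_mem T.bounded hx T.barycenter_mem_carrier

theorem exists_gap_zero_pos : ∃ x ∈ T.carrier, 0 < T.gap 0 x := by
  obtain ⟨x, hx⟩ : (interior T.carrier).Nonempty := T.interior_nonempty
  obtain ⟨r, hr, hball⟩ := Metric.nhds_basis_closedBall.mem_iff.1 (isOpen_interior.mem_nhds hx)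
  have hmem : x + (-r) • T.normal 0 ∈ T.carrier := by
    apply interior_subset
    apply hball
    simp [norm_smul, T.norm_normal, abs_of_pos hr]
  refine ⟨_, hmem, ?_⟩
  rw [gap_add, inner_smul_right, inner_normal_self]
  have := T.gap_nonneg (interior_subset hx) 0
  linarith

theorem size_pos : 0 < T.size := by
  obtain ⟨x, hx, hpos⟩ := T.exists_gap_zero_pos
  refine lt_of_lt_of_le ?_ (T.norm_sub_barycenter_le hx)
  rw [norm_pos_iff, sub_ne_zero]
  rintro rfl
  exact hpos.ne' T.gap_zero_barycenter

/-- Otherwise the normal of `e_i` is plus or minus that of `e`. Plus contradicts distinctness of the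
normals; minus, with a common point of the hyperplanes, would flatten `T` into a hyperplane. -/
theorem exists_tangent_inner_ne_zero {i : Fin n} {z : EuclideanSpace ℝ (Fin d)}
    (hz0 : T.gap 0 z = 0) (hzi : T.gap i.succ z = 0) :
    ∃ v ∈ T.tangent, inner ℝ (T.normal i.succ) v ≠ 0 := by
  by_contra! hcon
  have h1 : T.normal i.succ ∈ T.tangentᗮ := by
    rw [Submodule.mem_orthogonal']
    exact hcon
  rw [Submodule.orthogonal_orthogonal, Submodule.mem_span_singleton] at h1
  obtain ⟨c, hc⟩ := h1
  have hc1 : |c| = 1 := by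
    have := T.norm_normal i.succ
    rwa [← hc, norm_smul, T.norm_normal, mul_one, Real.norm_eq_abs] at this
  rcases eq_or_eq_neg_of_abs_eq hc1 with rfl | rfl
  · rw [one_smul] at hc
    exact Fin.succ_ne_zero i (T.normal_injective hc).symm
  · obtain ⟨x, hx, hpos⟩ := T.exists_gap_zero_pos
    have h2 := T.gap_nonneg hx i.succ
    simp only [gap, ← hc, neg_smul, one_smul, inner_neg_left] at h2 hzi hz0 hpos
    linarith

/-- The barycenter is interior to `e`, so if it lay on the hyperplane of `e_i`, one could move from
it both ways along a direction of `e` transversal to that hyperplane and leave `T`. -/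
theorem gap_barycenter_pos (i : Fin n) : 0 < T.gap i.succ T.barycenter := by
  refine lt_of_le_of_ne (T.gap_nonneg T.barycenter_mem_carrier _) fun h0 => ?_
  obtain ⟨v, hv, hne⟩ := T.exists_tangent_inner_ne_zero T.gap_zero_barycenter h0.symm
  obtain ⟨r, hr, hball⟩ := Metric.nhds_basis_closedBall.mem_iff.1
    (isOpen_interior.mem_nhds T.zero_mem_interior_footprint)
  have hmem : ∀ t : ℝ, |t| ≤ r / (‖v‖ + 1) → 0 ≤ - (t * inner ℝ (T.normal i.succ) v) := by
    intro t ht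
    have h1 : (t • (⟨v, hv⟩ : T.tangent)) ∈ T.footprint T.barycenter := by
      apply interior_subset
      apply hball
      rw [mem_closedBall_zero_iff, norm_smul, Real.norm_eq_abs]
      rw [le_div_iff₀ (by positivity)] at ht
      have : |t| * ‖v‖ ≤ |t| * (‖v‖ + 1) := by gcongr; linarith
      exact this.trans ht
    have h2 := T.gap_nonneg h1.1 i.succ
    rw [gap_add, ← h0] at h2
    simpa [inner_smul_right] using h2
  have hpos : 0 < r / (‖v‖ + 1) := by positivity
  have h1 := hmem (r / (‖v‖ + 1)) (by rw [abs_of_pos hpos])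
  have h2 := hmem (-(r / (‖v‖ + 1))) (by rw [abs_neg, abs_of_pos hpos])
  have : r / (‖v‖ + 1) * inner ℝ (T.normal i.succ) v = 0 := by linarith
  rcases mul_eq_zero.1 this with h | h
  · exact hpos.ne' h
  · exact hne h

/-- The points of the hyperplane of `e` on the lines through the barycenter that meet
`e ∩ e_i`, thickened in the normal direction. -/
noncomputable def shadow (i : Fin n) : Submodule ℝ (EuclideanSpace ℝ (Fin d)) :=
  (ℝ ∙ T.normal 0) ⊔ Submodule.span ℝ ((fun z => z - T.barycenter) '' (T.facet 0 ∩ T.facet i.succ))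

/-- If `e ∩ e_i` is nonempty but not of dimension `d - 2`, its dimension is at most `d - 3`; joining
it to the barycenter and adding the normal reaches at most `d - 1`. Generic rays therefore avoid
such intersections. -/
theorem shadow_ne_top (hd : 2 ≤ d) {i : Fin n} (hi : ¬ T.IsNeighbor i) : T.shadow i ≠ ⊤ := by
  intro htop
  have hfin : Module.finrank ℝ (T.shadow i) = d := by
    rw [htop, finrank_top, finrank_euclideanSpace_fin]
  rcases (T.facet 0 ∩ T.facet i.succ).eq_empty_or_nonempty with hS | ⟨z, hz⟩
  · rw [shadow, hS, Set.image_empty, Submodule.span_empty, sup_bot_eq,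
      finrank_span_singleton (T.normal_ne_zero 0)] at hfin
    omega
  · set S := T.facet 0 ∩ T.facet i.succ with hSdef
    have hle : T.shadow i ≤ (ℝ ∙ T.normal 0) ⊔ ((ℝ ∙ (z - T.barycenter)) ⊔ vectorSpan ℝ S) := by
      refine sup_le_sup_left (Submodule.span_le.2 ?_) _
      rintro _ ⟨y, hy, rfl⟩
      have : y - T.barycenter = (z - T.barycenter) + (y - z) := by abel
      simp only [SetLike.mem_coe]
      rw [this]
      exact Submodule.add_mem_sup (Submodule.mem_span_singleton_self _)
        (vsub_mem_vectorSpan ℝ hy hz)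
    have hvs : vectorSpan ℝ S < T.tangent := by
      have h0 : ∀ y ∈ S, T.gap 0 y = 0 ∧ T.gap i.succ y = 0 := fun y hy =>
        ⟨(T.mem_facet_iff.1 hy.1).2, (T.mem_facet_iff.1 hy.2).2⟩
      have key : ∀ j, (∀ y ∈ S, T.gap j y = 0) → vectorSpan ℝ S ≤ (ℝ ∙ T.normal j)ᗮ := by
        intro j hj
        rw [vectorSpan_def, Submodule.span_le]
        rintro _ ⟨y, hy, y', hy', rfl⟩
        rw [SetLike.mem_coe, Submodule.mem_orthogonal_singleton_iff_inner_right]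
        have h1 := hj y hy
        have h2 := hj y' hy'
        simp only [gap] at h1 h2
        simp only [vsub_eq_sub, inner_sub_right]
        linarith
      refine lt_of_le_of_ne (key 0 fun y hy => (h0 y hy).1) fun heq => ?_
      obtain ⟨v, hv, hne⟩ := T.exists_tangent_inner_ne_zero (h0 z hz).1 (h0 z hz).2
      rw [← heq] at hv
      exact hne (Submodule.mem_orthogonal_singleton_iff_inner_right.1
        (key i.succ (fun y hy => (h0 y hy).2) hv))
    have h1 := Submodule.finrank_lt_finrank_of_lt hvs
    rw [T.finrank_tangent] at h1
    have h2 : Module.finrank ℝ (vectorSpan ℝ S) + 2 ≠ d := fun h => hi ⟨⟨z, hz⟩, h⟩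
    have h3 := Submodule.finrank_mono hle
    have h4 := Submodule.finrank_add_le_finrank_add_finrank (ℝ ∙ T.normal 0)
      ((ℝ ∙ (z - T.barycenter)) ⊔ vectorSpan ℝ S)
    have h5 := Submodule.finrank_add_le_finrank_add_finrank (ℝ ∙ (z - T.barycenter))
      (vectorSpan ℝ S)
    have h6 : Module.finrank ℝ (ℝ ∙ T.normal 0) ≤ 1 := (finrank_span_le_card _).trans (by simp)
    have h7 : Module.finrank ℝ (ℝ ∙ (z - T.barycenter)) ≤ 1 := (finrank_span_le_card _).trans (by simp)
    omega

theorem exists_generic (hd : 2 ≤ d) {O : Set (EuclideanSpace ℝ (Fin d))} (hO : IsOpen O)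
    (hne : O.Nonempty) : ∃ x ∈ O, ∀ i, ¬ T.IsNeighbor i → x ∉ T.shadow i := by
  have hdense : Dense (⋂ i : {i : Fin n // ¬ T.IsNeighbor i},
      ((T.shadow i : Set (EuclideanSpace ℝ (Fin d))))ᶜ) := by
    refine dense_iInter_of_isOpen (fun i => ?_) fun i => ?_
    · exact (Submodule.closed_of_finiteDimensional _).isOpen_compl
    · rw [← interior_eq_empty_iff_dense_compl, ← Set.not_nonempty_iff_eq_empty]
      exact fun h => T.shadow_ne_top hd i.2 (Submodule.eq_top_of_nonempty_interior' _ h)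
  obtain ⟨x, hxO, hx⟩ := hdense.inter_open_nonempty O hO hne
  exact ⟨x, hxO, fun i hi => Set.mem_iInter.1 hx ⟨i, hi⟩⟩

/-- A segment in the hyperplane of `e` from the barycenter to a point outside `T` leaves `e`
through some `e_i`. -/
theorem exists_exit {w : EuclideanSpace ℝ (Fin d)} (hw : w ∈ T.tangent) {j : Fin (n + 1)}
    (hj : T.gap j (T.barycenter + w) < 0) :
    ∃ i : Fin n, ∃ t : ℝ, 0 < t ∧ t ≤ 1 ∧
      T.barycenter + t • w ∈ T.facet 0 ∩ T.facet i.succ := by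
  classical
  have hgap0 : ∀ t : ℝ, T.gap 0 (T.barycenter + t • w) = 0 := fun t => by
    rw [gap_add, T.gap_zero_barycenter, inner_smul_right, T.mem_tangent_iff.1 hw]; simp
  have hj0 : j ≠ 0 := by
    rintro rfl
    have := hgap0 1
    rw [one_smul] at this
    exact hj.ne this
  obtain ⟨j', rfl⟩ := Fin.exists_succ_eq.2 hj0
  set D : Fin n → ℝ := fun i => T.gap i.succ T.barycenter with hD
  set s : Fin n → ℝ := fun i => inner ℝ (T.normal i.succ) w with hs
  have hgap : ∀ (i : Fin n) (t : ℝ), T.gap i.succ (T.barycenter + t • w) = D i - t * s i :=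
    fun i t => by rw [gap_add, inner_smul_right]
  have hDpos : ∀ i, 0 < D i := T.gap_barycenter_pos
  have hj1 : D j' < s j' := by
    have := hgap j' 1
    rw [one_smul, one_mul] at this
    linarith
  obtain ⟨i, hi, hmin⟩ := Finset.exists_min_image (Finset.univ.filter fun i => D i < s i)
    (fun i => D i / s i) ⟨j', by simpa using hj1⟩
  have hi' : D i < s i := by simpa using hi
  have hsi : 0 < s i := (hDpos i).trans hi'
  refine ⟨i, D i / s i, div_pos (hDpos i) hsi, (div_le_one hsi).2 hi'.le, ?_⟩
  have hmem : T.barycenter + (D i / s i) • w ∈ T.carrier := by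
    rw [mem_carrier_iff]
    intro l
    refine Fin.cases ?_ (fun l => ?_) l
    · exact (hgap0 _).ge
    · rw [hgap, sub_nonneg]
      have ht0 : 0 < D i / s i := div_pos (hDpos i) hsi
      have ht1 : D i / s i ≤ 1 := (div_le_one hsi).2 hi'.le
      by_cases hl : D l < s l
      · have := hmin l (by simpa using hl)
        rwa [le_div_iff₀ ((hDpos l).trans hl)] at this
      · push Not at hl
        have := hDpos l
        nlinarith
  refine ⟨T.mem_facet_iff.2 ⟨hmem, hgap0 _⟩, T.mem_facet_iff.2 ⟨hmem, ?_⟩⟩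
  rw [hgap, div_mul_cancel₀ _ hsi.ne', sub_self]

/-- The distance condition concerns neighbors only, while a ray from `b` could leave `e` where it
meets a non-neighbor. A point outside `e` is therefore perturbed to generic position; its ray then
exits through a neighbor, at distance at least `h_T / 8`. -/
theorem ball_subset_footprint (hd : 2 ≤ d)
    (hlength : ∀ i, T.IsNeighbor i →
      T.size / 4 ≤ 2 * Metric.infDist T.barycenter (T.facet 0 ∩ T.facet i.succ)) :
    Metric.ball (0 : T.tangent) (T.size / 8) ⊆ T.footprint T.barycenter := by
  intro v hv
  rw [mem_ball_zero_iff] at hv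
  by_contra hnot
  have hg0 : T.gap 0 (T.barycenter + v) = 0 := by
    rw [gap_zero_add_tangent, gap_zero_barycenter]
  have : ∃ j, T.gap j (T.barycenter + v) < 0 := by
    by_contra! hcon
    exact hnot (T.mem_facet_iff.2 ⟨T.mem_carrier_iff.2 hcon, hg0⟩)
  obtain ⟨j, hj⟩ := this
  set p : EuclideanSpace ℝ (Fin d) → EuclideanSpace ℝ (Fin d) :=
    fun x => x - (inner ℝ (T.normal 0) x : ℝ) • T.normal 0 with hp
  have hpt : ∀ x, p x ∈ T.tangent := fun x => by
    rw [mem_tangent_iff, hp, inner_sub_right, inner_smul_right, inner_normal_self]; ring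
  have hpn : ∀ x, ‖p x‖ ≤ ‖x‖ := fun x => by
    have h1 : ‖x‖ ^ 2 = ‖p x‖ ^ 2 + (inner ℝ (T.normal 0) x : ℝ) ^ 2 := by
      rw [hp, norm_sub_sq_real, norm_smul, T.norm_normal, inner_smul_right,
        real_inner_comm, Real.norm_eq_abs, mul_one, sq_abs]
      ring
    exact le_of_sq_le_sq (by nlinarith [sq_nonneg (inner ℝ (T.normal 0) x : ℝ)]) (norm_nonneg _)
  -- The perturbation takes place in the full space and is projected by `p`; shadows contain the
  -- normal direction, so avoiding them depends on the projection alone.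
  obtain ⟨x, ⟨hx1, hx2⟩, hx3⟩ := T.exists_generic hd
    (O := Metric.ball 0 (T.size / 8) ∩ {x | T.gap j (T.barycenter + p x) < 0})
    (Metric.isOpen_ball.inter (isOpen_lt ((T.continuous_gap j).comp (by fun_prop))
      continuous_const))
    ⟨v, by simpa using hv, by
      have : p v = v := by rw [hp]; simp only []; rw [T.mem_tangent_iff.1 v.2]; simp
      show T.gap j (T.barycenter + p v) < 0
      rw [this]; exact hj⟩
  obtain ⟨i, t, ht0, ht1, hz⟩ := T.exists_exit (hpt x) hx2
  by_cases hi : T.IsNeighbor i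
  · have h1 := hlength i hi
    have h2 := Metric.infDist_le_dist_of_mem (x := T.barycenter) hz
    have h3 : dist T.barycenter (T.barycenter + t • p x) = t * ‖p x‖ := by
      rw [dist_eq_norm]; simp [norm_smul, abs_of_pos ht0]
    have h4 : ‖x‖ < T.size / 8 := by simpa using hx1
    have h5 := hpn x
    have h6 : t * ‖p x‖ ≤ ‖p x‖ := mul_le_of_le_one_left (norm_nonneg _) ht1
    linarith
  · apply hx3 i hi
    have h1 : t • p x ∈ T.shadow i := by
      apply Submodule.mem_sup_right
      apply Submodule.subset_span
      exact ⟨_, hz, by simp⟩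
    have h2 : p x ∈ T.shadow i := by
      have := (T.shadow i).smul_mem t⁻¹ h1
      rwa [smul_smul, inv_mul_cancel₀ ht0.ne', one_smul] at this
    have h3 : x = p x + (inner ℝ (T.normal 0) x : ℝ) • T.normal 0 := by simp [hp]
    rw [h3]
    exact (T.shadow i).add_mem h2
      (Submodule.mem_sup_left ((ℝ ∙ T.normal 0).smul_mem _ (Submodule.mem_span_singleton_self _)))

theorem closedBall_subset_footprint
    (h : Metric.ball (0 : T.tangent) (T.size / 8) ⊆ T.footprint T.barycenter) :
    Metric.closedBall (0 : T.tangent) (T.size / 8) ⊆ T.footprint T.barycenter := by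
  rw [← closure_ball _ (by have := T.size_pos; positivity)]
  exact closure_minimal h (T.isCompact_footprint _).isClosed

/-- The tangential part `τ` of the normal of `e_i` has length `sin α_i`, and the disc in `e` gives
`gap_i(b) ≥ (h_T / 8) ‖τ‖`. It remains to bound the growth of the gap from `b` to a point of `T`. -/
theorem gap_le_of_mem_carrier
    (hball : Metric.closedBall (0 : T.tangent) (T.size / 8) ⊆ T.footprint T.barycenter)
    {α₀ : ℝ} (hα₀ : 0 < α₀) (hsin : 0 < Real.sin α₀) {i : Fin n}
    (hangle : α₀ ≤ T.normalAngle i) {x : EuclideanSpace ℝ (Fin d)} (hx : x ∈ T.carrier) :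
    T.gap i.succ x ≤ 9 / Real.sin α₀ * T.gap i.succ T.barycenter := by
  have hh := T.size_pos
  set D := T.gap i.succ T.barycenter with hD
  have hDpos : 0 < D := T.gap_barycenter_pos i
  set c : ℝ := inner ℝ (T.normal 0) (T.normal i.succ) with hc
  have hcos : Real.cos (T.normalAngle i) = c := by
    rw [normalAngle, InnerProductGeometry.cos_angle, T.norm_normal, T.norm_normal]; simp [hc]
  set τ := T.normal i.succ - c • T.normal 0 with hτ
  have hτt : τ ∈ T.tangent := by
    rw [mem_tangent_iff, hτ, inner_sub_right, inner_smul_right, inner_normal_self]; simp [hc]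
  have hττ : (inner ℝ (T.normal i.succ) τ : ℝ) = ‖τ‖ ^ 2 := by
    have : (inner ℝ τ τ : ℝ) = inner ℝ (T.normal i.succ - c • T.normal 0) τ := by rw [← hτ]
    rw [← real_inner_self_eq_norm_sq, this, inner_sub_left, inner_smul_left,
      T.mem_tangent_iff.1 hτt]
    simp
  have hτn : ‖τ‖ = Real.sin (T.normalAngle i) := by
    have h1 : ‖τ‖ ^ 2 = 1 - c ^ 2 := by
      rw [← hττ, hτ, inner_sub_right, inner_smul_right, inner_normal_self, real_inner_comm, ← hc]
      ring
    have h2 : 0 ≤ Real.sin (T.normalAngle i) :=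
      Real.sin_nonneg_of_nonneg_of_le_pi (InnerProductGeometry.angle_nonneg _ _)
        (InnerProductGeometry.angle_le_pi _ _)
    rw [← sq_eq_sq₀ (norm_nonneg _) h2, h1, ← hcos, Real.sin_sq]
  have hDτ : T.size / 8 * ‖τ‖ ≤ D := by
    rcases eq_or_ne τ 0 with h0 | h0
    · rw [h0, norm_zero, mul_zero]; exact hDpos.le
    · have hn : 0 < ‖τ‖ := norm_pos_iff.2 h0
      have hv : (T.size / 8 / ‖τ‖) • (⟨τ, hτt⟩ : T.tangent) ∈ T.footprint T.barycenter := by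
        apply hball
        rw [mem_closedBall_zero_iff, norm_smul, Real.norm_eq_abs, abs_of_pos (by positivity)]
        simp only [Submodule.coe_norm]
        rw [div_mul_cancel₀ _ hn.ne']
      have h1 := T.gap_nonneg hv.1 i.succ
      rw [gap_add] at h1
      simp only [Submodule.coe_smul, inner_smul_right, hττ] at h1
      have h2 : T.size / 8 / ‖τ‖ * ‖τ‖ ^ 2 = T.size / 8 * ‖τ‖ := by field_simp
      rw [h2] at h1
      linarith
  set u := x - T.barycenter with hu
  have hun : ‖u‖ ≤ T.size := T.norm_sub_barycenter_le hx
  have hxb : x = T.barycenter + u := by simp [hu]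
  have hs1 : Real.sin α₀ ≤ 1 := Real.sin_le_one _
  have h9 : 9 * D ≤ 9 / Real.sin α₀ * D := by
    gcongr
    rw [le_div_iff₀ hsin]; linarith
  rw [hxb, gap_add, ← hD]
  -- For `c ≤ 0`, moving inward from `e` does not increase the gap, so only the tangential part
  -- counts and the growth is at most `‖τ‖ h_T ≤ 8 D`. For `c > 0` the angle is acute, `‖τ‖ ≥ sin
  -- α₀`, and the trivial growth bound `h_T` is at most `8 D / sin α₀`.
  rcases le_or_gt c 0 with hc0 | hc0
  · have e1 : (inner ℝ (T.normal i.succ) u : ℝ) = c * inner ℝ (T.normal 0) u + inner ℝ τ u := by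
      rw [hτ, inner_sub_left, inner_smul_left]; simp
    have e2 : (inner ℝ (T.normal 0) u : ℝ) = - T.gap 0 x := by
      rw [hxb, gap_add, gap_zero_barycenter]; ring
    have e3 := T.gap_nonneg hx 0
    have e4 := neg_le_of_abs_le (abs_real_inner_le_norm τ u)
    have e5 : ‖τ‖ * ‖u‖ ≤ ‖τ‖ * T.size := by gcongr
    rw [e1, e2]
    nlinarith
  · have hle : Real.sin α₀ ≤ ‖τ‖ := by
      rw [hτn]
      have hlt : T.normalAngle i < Real.pi / 2 := by
        by_contra! hcon
        have := Real.cos_nonpos_of_pi_div_two_le_of_le hcon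
          (by linarith [InnerProductGeometry.angle_le_pi (T.normal 0) (T.normal i.succ),
            Real.pi_pos, show T.normalAngle i ≤ Real.pi from
              InnerProductGeometry.angle_le_pi _ _])
        rw [hcos] at this
        linarith
      exact Real.sin_le_sin_of_le_of_le_pi_div_two (by linarith [Real.pi_pos]) hlt.le hangle
    have e4 := neg_le_of_abs_le (abs_real_inner_le_norm (T.normal i.succ) u)
    rw [T.norm_normal, one_mul] at e4
    have e6 : T.size * Real.sin α₀ ≤ 8 * D := by nlinarith
    have e7 : D * Real.sin α₀ ≤ D := by nlinarith
    rw [div_mul_eq_mul_div, le_div_iff₀ hsin]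
    nlinarith

/-- With fewer than `d` other normals, some direction is orthogonal to all of them; with the right
sign it points into the half-space of `e`, and `T` contains a ray. The comparison of constants needs
`n` this large. -/
theorem dim_le (T : ConvexPolytope d n) : d ≤ n := by
  by_contra! hlt
  set W := Submodule.span ℝ (Set.range fun i : Fin n => T.normal i.succ) with hW
  have h1 : Module.finrank ℝ W ≤ n := by
    have := finrank_range_le_card (R := ℝ) (fun i : Fin n => T.normal i.succ)
    rwa [Fintype.card_fin] at this
  have h2 : Wᗮ ≠ ⊥ := by
    intro h
    have := Submodule.finrank_add_finrank_orthogonal W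
    rw [h, finrank_bot, finrank_euclideanSpace_fin] at this
    omega
  obtain ⟨v, hv, hv0⟩ := Submodule.exists_mem_ne_zero_of_ne_bot h2
  obtain ⟨v, hv, hv0, hle⟩ : ∃ v ∈ Wᗮ, v ≠ 0 ∧ (inner ℝ (T.normal 0) v : ℝ) ≤ 0 := by
    rcases le_total (inner ℝ (T.normal 0) v : ℝ) 0 with h | h
    · exact ⟨v, hv, hv0, h⟩
    · exact ⟨-v, Wᗮ.neg_mem hv, neg_ne_zero.2 hv0, by rw [inner_neg_right]; linarith⟩
  have hmem : ∀ t : ℝ, 0 ≤ t → T.barycenter + t • v ∈ T.carrier := by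
    intro t ht
    rw [mem_carrier_iff]
    intro i
    rw [gap_add, inner_smul_right]
    have hb := T.gap_nonneg T.barycenter_mem_carrier i
    refine Fin.cases (fun hb => ?_) (fun i hb => ?_) i hb
    · nlinarith
    · have : (inner ℝ (T.normal i.succ) v : ℝ) = 0 :=
        (Submodule.mem_orthogonal _ _).1 hv _ (Submodule.subset_span ⟨i, rfl⟩)
      rw [this]; linarith
  have hn : 0 < ‖v‖ := norm_pos_iff.2 hv0
  have hh := T.size_pos
  have := T.norm_sub_barycenter_le (hmem (2 * T.size / ‖v‖) (by positivity))
  rw [add_sub_cancel_left, norm_smul, Real.norm_eq_abs, abs_of_pos (by positivity),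
    div_mul_cancel₀ _ hn.ne'] at this
  linarith

end ConvexPolytope

/-! ### Fubini in the normal direction of `e`. -/

namespace ConvexPolytope

variable {d n : ℕ} (T : ConvexPolytope d n)

theorem volume_slab (a : ℝ) :
    volume {t : ↥(ℝ ∙ T.normal 0) | (inner ℝ (T.normal 0) (t : EuclideanSpace ℝ (Fin d)) : ℝ) ∈
      Set.Icc (-a) 0} = ENNReal.ofReal a := by
  set e := LinearIsometryEquiv.toSpanUnitSingleton (𝕜 := ℝ) (T.normal 0) (T.norm_normal 0)
  rw [← e.measurePreserving.measure_preimage]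
  · have : e ⁻¹' {t : ↥(ℝ ∙ T.normal 0) |
        (inner ℝ (T.normal 0) (t : EuclideanSpace ℝ (Fin d)) : ℝ) ∈ Set.Icc (-a) 0} =
        Set.Icc (-a) 0 := by
      ext r
      simp [e, inner_smul_right, T.norm_normal]
    rw [this, Real.volume_Icc]
    simp
  · refine (measurableSet_Icc.preimage ?_).nullMeasurableSet
    fun_prop

/-- The integral over `T` of a function that is constant in the normal direction of `e`. -/
theorem setIntegral_proj_le {f : EuclideanSpace ℝ (Fin d) → ℝ} (hf : Continuous f)
    (hf0 : ∀ x, 0 ≤ f x) :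
    ∫ x in T.carrier, f (x + T.gap 0 x • T.normal 0) ≤
      T.size * ∫ v in Metric.closedBall (0 : T.tangent) T.size,
        f (T.barycenter + (v : EuclideanSpace ℝ (Fin d))) := by
  set s : Submodule ℝ (EuclideanSpace ℝ (Fin d)) := ℝ ∙ T.normal 0 with hs
  set b := T.barycenter with hb
  set e := s.measurableEquivProd b with he
  have hmp : MeasurePreserving e (volume : Measure (EuclideanSpace ℝ (Fin d))) volume := by
    have := s.measurePreserving_measurableEquivProd b
    rwa [InnerProductSpace.euclideanHausdorffMeasure_eq_volume] at this
  set A : Set s := {t : s | (inner ℝ (T.normal 0) (t : EuclideanSpace ℝ (Fin d)) : ℝ) ∈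
      Set.Icc (-T.size) 0} with hA
  set B := Metric.closedBall (0 : T.tangent) T.size with hB
  have hAm : MeasurableSet A := measurableSet_Icc.preimage (by fun_prop)
  have hBm : MeasurableSet B := Metric.isClosed_closedBall.measurableSet
  have hAv : volume A = ENNReal.ofReal T.size := T.volume_slab T.size
  have hdec : ∀ x, x - b = ((e x).1 : EuclideanSpace ℝ (Fin d)) + (e x).2 := by
    intro x
    have := e.symm_apply_apply x
    rw [he, Submodule.measurableEquivProd_symm_apply, ← he] at this
    conv_lhs => rw [← this]
    simp
  have hin : ∀ x, (inner ℝ (T.normal 0) ((e x).1 : EuclideanSpace ℝ (Fin d)) : ℝ) =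
      - T.gap 0 x := by
    intro x
    have h1 : (inner ℝ (T.normal 0) ((e x).2 : EuclideanSpace ℝ (Fin d)) : ℝ) = 0 :=
      T.mem_tangent_iff.1 (e x).2.2
    have h2 := T.gap_add 0 b (x - b)
    rw [add_sub_cancel, T.gap_zero_barycenter, hdec x, inner_add_right, h1] at h2
    linarith
  have hfst : ∀ x, ((e x).1 : EuclideanSpace ℝ (Fin d)) = - T.gap 0 x • T.normal 0 := by
    intro x
    obtain ⟨c, hc⟩ := Submodule.mem_span_singleton.1 (e x).1.2
    have := hin x
    rw [← hc, inner_smul_right, inner_normal_self, mul_one] at this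
    rw [← hc, this]
  have hproj : ∀ x, x + T.gap 0 x • T.normal 0 = b + (e x).2 := by
    intro x
    have h1 := hdec x
    rw [hfst x] at h1
    rw [sub_eq_iff_eq_add] at h1
    nth_rewrite 1 [h1]
    module
  -- In coordinates centered at `b`, `T` lies in a slab of thickness `h_T` times a disc of radius
  -- `h_T`, because every point of `T` is within `h_T` of `b`.
  have hsub : T.carrier ⊆ e ⁻¹' (A ×ˢ B) := by
    intro x hx
    have hn := T.norm_sub_barycenter_le hx
    have h0 := T.gap_nonneg hx 0
    refine ⟨?_, ?_⟩
    · show (inner ℝ (T.normal 0) ((e x).1 : EuclideanSpace ℝ (Fin d)) : ℝ) ∈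
        Set.Icc (-T.size) 0
      have h1 := abs_real_inner_le_norm (T.normal 0) (x - b)
      have h2 := T.gap_add 0 b (x - b)
      rw [add_sub_cancel, T.gap_zero_barycenter] at h2
      rw [T.norm_normal, one_mul] at h1
      rw [hin]
      constructor
      · linarith [neg_le_of_abs_le h1]
      · linarith
    · show (e x).2 ∈ B
      rw [hB, mem_closedBall_zero_iff]
      refine le_trans ?_ hn
      rw [he, Submodule.measurableEquivProd_apply]
      exact Submodule.norm_orthogonalProjectionOnto_apply_le _ _
  have hgc : Continuous fun v : T.tangent => f (b + (v : EuclideanSpace ℝ (Fin d))) := by fun_prop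
  have hBi : IntegrableOn (fun v : T.tangent => f (b + (v : EuclideanSpace ℝ (Fin d)))) B volume :=
    hgc.continuousOn.integrableOn_compact (isCompact_closedBall _ _)
  have hAi : IntegrableOn (fun _ : s => (1 : ℝ)) A volume := by
    rw [integrableOn_const_iff]; right; rw [hAv]; exact ENNReal.ofReal_lt_top
  have hprodi : IntegrableOn (fun y : s × T.tangent => (1 : ℝ) *
      f (b + (y.2 : EuclideanSpace ℝ (Fin d)))) (A ×ˢ B) (volume.prod volume) := by
    rw [IntegrableOn, ← Measure.prod_restrict]
    exact Integrable.mul_prod hAi hBi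
  have e1 : ∫ x in e ⁻¹' (A ×ˢ B), f (b + (e x).2) = T.size * ∫ v in B, f (b + v) := by
    rw [hmp.setIntegral_preimage_emb e.measurableEmbedding
      (fun y : s × T.tangent => f (b + (y.2 : EuclideanSpace ℝ (Fin d))))]
    have := setIntegral_prod_mul (μ := (volume : Measure s)) (ν := (volume : Measure T.tangent))
      (fun _ => (1 : ℝ)) (fun v : T.tangent => f (b + (v : EuclideanSpace ℝ (Fin d)))) A B
    simp only [one_mul] at this
    rw [Measure.volume_eq_prod, this]
    congr 1
    rw [setIntegral_const, Measure.real, hAv, ENNReal.toReal_ofReal T.size_pos.le]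
    simp
  simp_rw [hproj]
  rw [← e1]
  refine setIntegral_mono_set ?_ (Filter.Eventually.of_forall fun x => hf0 _) hsub.eventuallyLE
  have h3 := (hmp.integrableOn_comp_preimage e.measurableEmbedding (s := A ×ˢ B)
    (f := fun y : s × T.tangent => (1 : ℝ) * f (b + (y.2 : EuclideanSpace ℝ (Fin d))))).2
    (by rw [Measure.volume_eq_prod]; exact hprodi)
  simpa [Function.comp_def] using h3

end ConvexPolytope

/-! ### Polynomial functions: restriction to lines and division by an affine polynomial. -/

section Poly

open MvPolynomial

variable {d : ℕ}

theorem continuous_polyVal (p : MvPolynomial (Fin d) ℝ) : Continuous (polyVal p) := by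
  have : polyVal p = fun x : EuclideanSpace ℝ (Fin d) => MvPolynomial.eval (fun i => x i) p := rfl
  rw [this]
  exact (MvPolynomial.continuous_eval p).comp (by fun_prop)

@[simp] theorem polyVal_add (p r : MvPolynomial (Fin d) ℝ) (x) :
    polyVal (p + r) x = polyVal p x + polyVal r x := by simp [polyVal]

@[simp] theorem polyVal_sub (p r : MvPolynomial (Fin d) ℝ) (x) :
    polyVal (p - r) x = polyVal p x - polyVal r x := by simp [polyVal]

@[simp] theorem polyVal_mul (p r : MvPolynomial (Fin d) ℝ) (x) :
    polyVal (p * r) x = polyVal p x * polyVal r x := by simp [polyVal]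

@[simp] theorem polyVal_smul (c : ℝ) (p : MvPolynomial (Fin d) ℝ) (x) :
    polyVal (c • p) x = c * polyVal p x := by simp [polyVal, MvPolynomial.smul_eval]

@[simp] theorem polyVal_zero (x) : polyVal (0 : MvPolynomial (Fin d) ℝ) x = 0 := by
  simp [polyVal]

@[simp] theorem polyVal_C (c : ℝ) (x) : polyVal (C c : MvPolynomial (Fin d) ℝ) x = c := by
  simp [polyVal]

@[simp] theorem polyVal_X (i : Fin d) (x) : polyVal (X i : MvPolynomial (Fin d) ℝ) x = x i := by
  simp [polyVal]

theorem polyVal_prod {ι : Type*} (s : Finset ι) (p : ι → MvPolynomial (Fin d) ℝ) (x) :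
    polyVal (∏ i ∈ s, p i) x = ∏ i ∈ s, polyVal (p i) x := by
  simp [polyVal]

theorem polyVal_sum {ι : Type*} (s : Finset ι) (p : ι → MvPolynomial (Fin d) ℝ) (x) :
    polyVal (∑ i ∈ s, p i) x = ∑ i ∈ s, polyVal (p i) x := by
  simp [polyVal]

theorem polyVal_ext {p r : MvPolynomial (Fin d) ℝ} (h : ∀ x, polyVal p x = polyVal r x) :
    p = r := by
  refine MvPolynomial.funext fun x => ?_
  exact h (WithLp.toLp 2 x)

/-- The restriction of a polynomial to a line. -/
theorem exists_polynomial_line (p : MvPolynomial (Fin d) ℝ) {k : ℕ} (hp : p.totalDegree ≤ k)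
    (a w : EuclideanSpace ℝ (Fin d)) :
    ∃ P : Polynomial ℝ, P.natDegree ≤ k ∧ ∀ t, P.eval t = polyVal p (a + t • w) := by
  refine ⟨MvPolynomial.aeval (fun i => Polynomial.C (w i) * Polynomial.X + Polynomial.C (a i)) p,
    ?_, fun t => ?_⟩
  · have := MvPolynomial.aeval_natDegree_le p hp
      (fun i => Polynomial.C (w i) * Polynomial.X + Polynomial.C (a i)) (n := 1)
      (fun i => Polynomial.natDegree_linear_le)
    simpa using this
  · have h1 := MvPolynomial.eval₂_comp_left (Polynomial.evalRingHom t)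
      (algebraMap ℝ (Polynomial ℝ))
      (fun i => Polynomial.C (w i) * Polynomial.X + Polynomial.C (a i)) p
    rw [MvPolynomial.aeval_def]
    simp only [Polynomial.coe_evalRingHom] at h1
    rw [h1, polyVal, MvPolynomial.eval, MvPolynomial.coe_eval₂Hom]
    congr 1
    · ext r; simp
    · funext i
      simp
      ring

theorem eq_zero_of_polyVal_eq_zero {p : MvPolynomial (Fin d) ℝ}
    {U : Set (EuclideanSpace ℝ (Fin d))} (hU : (interior U).Nonempty)
    (h : ∀ x ∈ U, polyVal p x = 0) : p = 0 := by
  obtain ⟨a, ha⟩ := hU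
  refine polyVal_ext fun x => ?_
  obtain ⟨P, -, hP⟩ := exists_polynomial_line p le_rfl a (x - a)
  have hP0 : P = 0 := by
    refine Polynomial.eq_zero_of_infinite_isRoot P ?_
    have hc : Continuous fun t : ℝ => a + t • (x - a) := by fun_prop
    have hopen : IsOpen ((fun t : ℝ => a + t • (x - a)) ⁻¹' interior U) :=
      isOpen_interior.preimage hc
    have hmem : (0 : ℝ) ∈ (fun t : ℝ => a + t • (x - a)) ⁻¹' interior U := by simpa using ha
    refine (infinite_of_mem_nhds (0 : ℝ) (hopen.mem_nhds hmem)).mono fun t ht => ?_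
    show P.eval t = 0
    rw [hP]
    exact h _ (interior_subset ht)
  have := hP 1
  rw [one_smul, add_sub_cancel, hP0, Polynomial.eval_zero] at this
  rw [← this, polyVal_zero]

/-- Division of a polynomial by the polynomial `y` of degree at most one; the remainder is the
composition with the shift by `y ν`. -/
theorem exists_polyVal_eq_proj_add (ν : EuclideanSpace ℝ (Fin d)) (y : MvPolynomial (Fin d) ℝ)
    (hyd : y.totalDegree ≤ 1) (k : ℕ)
    (q : MvPolynomial (Fin d) ℝ) (hq : q.totalDegree ≤ k) :
    ∃ u : MvPolynomial (Fin d) ℝ, (u = 0 ∨ u.totalDegree + 1 ≤ k) ∧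
      ∀ x, polyVal q x = polyVal q (x + polyVal y x • ν) + polyVal y x * polyVal u x := by
  have hmon : ∀ k : ℕ, ∀ (s : Fin d →₀ ℕ) (a : ℝ), s.degree ≤ k →
      ∃ u : MvPolynomial (Fin d) ℝ, (u = 0 ∨ u.totalDegree + 1 ≤ k) ∧
      ∀ x, polyVal (monomial s a) x =
        polyVal (monomial s a) (x + polyVal y x • ν) + polyVal y x * polyVal u x := by
    intro k
    induction k with
    | zero =>
      intro s a hs
      have : s = 0 := by
        rw [← Finsupp.degree_eq_zero_iff]; omega
      subst this
      refine ⟨0, Or.inl rfl, fun x => ?_⟩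
      have : (monomial (0 : Fin d →₀ ℕ) a) = C a := rfl
      simp [this]
    | succ k ih =>
      intro s a hs
      by_cases hs0 : s = 0
      · subst hs0
        refine ⟨0, Or.inl rfl, fun x => ?_⟩
        have : (monomial (0 : Fin d →₀ ℕ) a) = C a := rfl
        simp [this]
      obtain ⟨i, hi⟩ : ∃ i, s i ≠ 0 := by
        by_contra! hcon
        exact hs0 (Finsupp.ext hcon)
      obtain ⟨s', rfl⟩ : ∃ s', s = Finsupp.single i 1 + s' :=
        ⟨s - Finsupp.single i 1, by
          rw [add_tsub_cancel_of_le]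
          rw [Finsupp.single_le_iff]; omega⟩
      have hs' : s'.degree ≤ k := by
        rw [map_add, Finsupp.degree_single] at hs; omega
      obtain ⟨u, hu, hux⟩ := ih s' a hs'
      have hfac : monomial (Finsupp.single i 1 + s') a = X i * monomial s' a := by
        rw [X, monomial_mul, one_mul]
      have hmd : (monomial s' a).totalDegree ≤ k := (totalDegree_monomial_le s' a).trans hs'
      -- Let `m` be the smaller monomial and `m ∘ π = m - y u` its shifted version. Then `x_i m -
      -- (x_i + y ν_i)(m - y u) = y (x_i u - ν_i (m - y u))`.
      refine ⟨X i * u - C (ν i) * (monomial s' a - y * u), Or.inr ?_, fun x => ?_⟩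
      · have h1 : (X i * u : MvPolynomial (Fin d) ℝ).totalDegree ≤ k := by
          rcases hu with rfl | hu
          · simp
          · refine (totalDegree_mul _ _).trans ?_
            rw [totalDegree_X]; omega
        have h2 : (y * u).totalDegree ≤ k := by
          rcases hu with rfl | hu
          · simp
          · refine (totalDegree_mul _ _).trans ?_
            omega
        have h3 : (C (ν i) * (monomial s' a - y * u)).totalDegree ≤ k := by
          refine (totalDegree_mul _ _).trans ?_
          rw [totalDegree_C, zero_add]
          exact (totalDegree_sub _ _).trans (max_le hmd h2)
        exact Nat.succ_le_succ ((totalDegree_sub _ _).trans (max_le h1 h3))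
      · rw [hfac]
        have hm := hux x
        simp only [polyVal_mul, polyVal_sub, polyVal_X, polyVal_C, PiLp.add_apply, PiLp.smul_apply,
          smul_eq_mul]
        linear_combination (x i + polyVal y x * ν i) * hm
  choose! u hu hux using fun s (hs : s ∈ q.support) =>
    hmon k s (coeff s q) ((MvPolynomial.le_totalDegree hs).trans hq)
  refine ⟨∑ s ∈ q.support, u s, ?_, fun x => ?_⟩
  · by_cases hk : k = 0
    · left
      refine Finset.sum_eq_zero fun s hs => ?_
      rcases hu s hs with h | h
      · exact h
      · omega
    · right
      have : (∑ s ∈ q.support, u s).totalDegree ≤ k - 1 := by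
        refine totalDegree_finsetSum_le fun s hs => ?_
        rcases hu s hs with h | h
        · simp [h]
        · omega
      omega
  · conv_lhs => rw [q.as_sum]
    conv_rhs => enter [1]; rw [q.as_sum]
    rw [polyVal_sum, polyVal_sum, polyVal_sum, Finset.mul_sum, ← Finset.sum_add_distrib]
    exact Finset.sum_congr rfl fun s hs => hux s hs x

end Poly

/-! ### Weighted Cauchy–Schwarz and solvability for degenerate forms. -/

theorem integral_mul_sq_le_of_weight {Ω : Type*} [MeasurableSpace Ω] {μ : Measure Ω}
    {w f g : Ω → ℝ} (hw : 0 ≤ᵐ[μ] w) (hf : Integrable (fun x => w x * f x ^ 2) μ)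
    (hfg : Integrable (fun x => w x * (f x * g x)) μ)
    (hg : Integrable (fun x => w x * g x ^ 2) μ) :
    (∫ x, w x * (f x * g x) ∂μ) ^ 2 ≤ (∫ x, w x * f x ^ 2 ∂μ) * ∫ x, w x * g x ^ 2 ∂μ := by
  have key : ∀ t : ℝ, 0 ≤ (∫ x, w x * f x ^ 2 ∂μ) * (t * t) +
      (2 * ∫ x, w x * (f x * g x) ∂μ) * t + ∫ x, w x * g x ^ 2 ∂μ := by
    intro t
    have e : (∫ x, w x * f x ^ 2 ∂μ) * (t * t) + (2 * ∫ x, w x * (f x * g x) ∂μ) * t +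
        ∫ x, w x * g x ^ 2 ∂μ = ∫ x, w x * (t * f x + g x) ^ 2 ∂μ := by
      have hsum : Integrable (fun x => w x * f x ^ 2 * (t * t) + 2 * (w x * (f x * g x)) * t) μ :=
        (hf.mul_const _).add ((hfg.const_mul _).mul_const _)
      rw [← integral_mul_const, ← integral_const_mul, ← integral_mul_const,
        ← integral_add (hf.mul_const _) ((hfg.const_mul _).mul_const _), ← integral_add hsum hg]
      refine integral_congr_ae (Filter.Eventually.of_forall fun x => ?_)
      ring
    rw [e]
    refine integral_nonneg_of_ae ?_
    filter_upwards [hw] with x hx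
    exact mul_nonneg hx (sq_nonneg _)
  have := discrim_le_zero key
  rw [discrim] at this
  nlinarith

/-- If `l` were outside the range of `B`, a functional on the dual, that is, evaluation at some `x`,
would kill the range but not `l`; then `B x x = 0`. No definiteness is required, which matters
because polynomials on `ℝ^d` may vanish on `e`. -/
theorem exists_forall_apply_eq {X : Type*} [AddCommGroup X] [Module ℝ X] [FiniteDimensional ℝ X]
    (B : X →ₗ[ℝ] X →ₗ[ℝ] ℝ) (l : X →ₗ[ℝ] ℝ) (h : ∀ x, B x x = 0 → l x = 0) :
    ∃ y, ∀ x, B y x = l x := by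
  suffices l ∈ LinearMap.range B by
    obtain ⟨y, hy⟩ := this
    exact ⟨y, fun x => by rw [hy]⟩
  by_contra hl
  obtain ⟨f, hf, hle⟩ := Submodule.exists_le_ker_of_notMem hl
  obtain ⟨x, rfl⟩ := (Module.evalEquiv ℝ X).surjective f
  apply hf
  have : B x ∈ LinearMap.ker ((Module.evalEquiv ℝ X) x) := hle ⟨x, rfl⟩
  simp only [LinearMap.mem_ker, Module.evalEquiv_apply] at this ⊢
  exact h x this

/-! ### The weight `λ_1 ⋯ λ_n` and the norms it controls. -/

namespace ConvexPolytope

variable {d n : ℕ} (T : ConvexPolytope d n)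

theorem integrable_surface {f : EuclideanSpace ℝ (Fin d) → ℝ} (hf : Continuous f) :
    Integrable f T.surface := by
  rw [T.surface_eq_map T.gap_zero_barycenter]
  have hiso := T.isometry_add_tangent T.barycenter
  rw [hiso.isClosedEmbedding.measurableEmbedding.integrable_map_iff]
  exact (hf.comp hiso.continuous).continuousOn.integrableOn_compact (T.isCompact_footprint _)

theorem integrable_bulk {f : EuclideanSpace ℝ (Fin d) → ℝ} (hf : Continuous f) :
    Integrable f T.bulk :=
  hf.continuousOn.integrableOn_compact T.isCompact_carrier

theorem ae_bulk {p : EuclideanSpace ℝ (Fin d) → Prop} (h : ∀ x ∈ T.carrier, p x) :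
    ∀ᵐ x ∂T.bulk, p x :=
  (ae_restrict_mem T.isClosed_carrier.measurableSet).mono h

theorem ae_surface {p : EuclideanSpace ℝ (Fin d) → Prop} (h : ∀ x ∈ T.carrier, p x) :
    ∀ᵐ x ∂T.surface, p x :=
  (ae_restrict_mem (T.isClosed_facet 0).measurableSet).mono fun x hx => h x hx.1

/-- The common value of all admissible products `λ_1 ⋯ λ_n`. -/
noncomputable def weight (x : EuclideanSpace ℝ (Fin d)) : ℝ :=
  ∏ i : Fin n, T.gap i.succ x / T.gap i.succ T.barycenter

theorem continuous_weight : Continuous T.weight :=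
  continuous_finsetProd _ fun i _ => (T.continuous_gap i.succ).div_const _

theorem weight_nonneg {x : EuclideanSpace ℝ (Fin d)} (hx : x ∈ T.carrier) : 0 ≤ T.weight x :=
  Finset.prod_nonneg fun i _ => div_nonneg (T.gap_nonneg hx _) (T.gap_barycenter_pos i).le

theorem weight_le {W : ℝ}
    (hW : ∀ x ∈ T.carrier, ∀ i : Fin n, T.gap i.succ x ≤ W * T.gap i.succ T.barycenter)
    {x : EuclideanSpace ℝ (Fin d)} (hx : x ∈ T.carrier) : T.weight x ≤ W ^ n := by
  have : T.weight x ≤ ∏ _i : Fin n, W := by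
    refine Finset.prod_le_prod
      (fun i _ => div_nonneg (T.gap_nonneg hx _) (T.gap_barycenter_pos i).le) fun i _ => ?_
    rw [div_le_iff₀ (T.gap_barycenter_pos i)]
    exact hW x hx i
  simpa using this

theorem pow_le_weight {c : ℝ} (hc : 0 ≤ c) {x : EuclideanSpace ℝ (Fin d)}
    (h : ∀ i : Fin n, c * T.gap i.succ T.barycenter ≤ T.gap i.succ x) : c ^ n ≤ T.weight x := by
  have : ∏ _i : Fin n, c ≤ T.weight x := by
    refine Finset.prod_le_prod (fun i _ => hc) fun i _ => ?_
    rw [le_div_iff₀ (T.gap_barycenter_pos i)]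
    exact h i
  simpa using this

/-- Dilates of ratio up to `2 / M` stay in `e`, so those of ratio up to `1 / M` are midpoints of `b`
and a point of `e`. Affine gaps keep half their value at `b` there, and the weight is at least
`2⁻ⁿ`. -/
theorem setIntegral_sq_le_surface (hd : d ≤ 3) (k M : ℕ) (hM : 2 ≤ M)
    {p : MvPolynomial (Fin d) ℝ} (hp : p.totalDegree ≤ k) {K : Set T.tangent} (hK : IsCompact K)
    (h : ∀ v ∈ K, ∀ r : ℝ, 0 < r → r ≤ 2 / M → r • v ∈ T.footprint T.barycenter) :
    ∫ v in K, polyVal p (T.barycenter + (v : EuclideanSpace ℝ (Fin d))) ^ 2 ≤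
      2 ^ n * ((M : ℝ) ^ (d - 1) * dilationConst k M ^ 2) *
        ∫ x, T.weight x * polyVal p x ^ 2 ∂T.surface := by
  set b := T.barycenter with hb
  set f : T.tangent → ℝ := fun v => polyVal p (b + (v : EuclideanSpace ℝ (Fin d))) with hf
  have hfc : Continuous f := (continuous_polyVal p).comp (by fun_prop)
  set F := T.footprint b with hF
  have hFc : IsCompact F := T.isCompact_footprint b
  set K' : Set T.tangent := F ∩ {v | ∀ i : Fin n, 1 / 2 * T.gap i.succ b ≤
    T.gap i.succ (b + (v : EuclideanSpace ℝ (Fin d)))} with hK'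
  have hcl : IsClosed {v : T.tangent | ∀ i : Fin n, 1 / 2 * T.gap i.succ b ≤
      T.gap i.succ (b + (v : EuclideanSpace ℝ (Fin d)))} := by
    rw [Set.ofPred_forall]
    exact isClosed_iInter fun i => isClosed_le continuous_const
      ((T.continuous_gap _).comp (by fun_prop))
  have hK'c : IsCompact K' := hFc.inter_right hcl
  have hmem : ∀ v ∈ K, ∀ r : ℝ, 0 < r → r ≤ 1 / M → (0 : T.tangent) + r • (v - 0) ∈ K' := by
    intro v hv r hr hrM
    have h2 : (2 * r) • v ∈ F := h v hv (2 * r) (by linarith) (by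
      rw [show (2 : ℝ) / M = 2 * (1 / M) by ring]; linarith)
    have hmid : b + ((r • v : T.tangent) : EuclideanSpace ℝ (Fin d)) =
        b + (1 / 2 : ℝ) • ((b + (((2 * r) • v : T.tangent) : EuclideanSpace ℝ (Fin d))) - b) := by
      simp only [Submodule.coe_smul]
      module
    rw [zero_add, sub_zero]
    refine ⟨T.mem_facet_iff.2 ⟨?_, ?_⟩, fun i => ?_⟩
    · rw [hmid]
      exact T.segment_mem_carrier T.barycenter_mem_carrier h2.1 (by norm_num) (by norm_num)
    · rw [gap_zero_add_tangent, hb, gap_zero_barycenter]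
    · rw [hmid, gap_segment]
      have := T.gap_nonneg h2.1 i.succ
      linarith
  have hfin : Module.finrank ℝ T.tangent = d - 1 := T.finrank_tangent
  have h1 := setIntegral_sq_le_of_dilation (volume : Measure T.tangent) k M hM 0 hfc
    (fun v => by
      obtain ⟨P, hP, hPe⟩ := exists_polynomial_line p hp b (v : EuclideanSpace ℝ (Fin d))
      exact ⟨P, hP, fun t => by rw [hPe, hf]; simp⟩)
    -- The hyperplane has dimension at most `2`, so `ρ ^ (d - 1) ≤ ρ ^ 2` for `ρ ≥ 1`.
    hK hK'c hmem (c := 1) (fun j hj => by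
      rw [hfin, one_mul]
      refine pow_le_pow_right₀ ?_ (by omega)
      rw [one_le_div (by positivity)]
      have : (j : ℝ) ≤ k := by exact_mod_cast (by omega : j ≤ k)
      linarith)
  rw [hfin, mul_one] at h1
  have hwc : Continuous fun v : T.tangent => T.weight (b + (v : EuclideanSpace ℝ (Fin d))) :=
    T.continuous_weight.comp (by fun_prop)
  have hwfi : IntegrableOn (fun v : T.tangent =>
      T.weight (b + (v : EuclideanSpace ℝ (Fin d))) * f v ^ 2) F :=
    (hwc.mul (hfc.pow 2)).continuousOn.integrableOn_compact hFc
  have h2 : ∫ v in K', f v ^ 2 ≤ 2 ^ n *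
      ∫ v in F, T.weight (b + (v : EuclideanSpace ℝ (Fin d))) * f v ^ 2 := by
    rw [← integral_const_mul]
    refine le_trans (b := ∫ v in K', 2 ^ n *
      (T.weight (b + (v : EuclideanSpace ℝ (Fin d))) * f v ^ 2)) ?_ ?_
    · refine setIntegral_mono_on ((hfc.pow 2).continuousOn.integrableOn_compact hK'c)
        ((hwfi.mono_set Set.inter_subset_left).const_mul _) hK'c.measurableSet fun v hv => ?_
      have h3 := T.pow_le_weight (by norm_num) hv.2
      have h4 : (1 : ℝ) ≤ 2 ^ n * T.weight (b + (v : EuclideanSpace ℝ (Fin d))) := by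
        calc (1 : ℝ) = 2 ^ n * (1 / 2) ^ n := by rw [← mul_pow]; norm_num
          _ ≤ _ := by gcongr
      nlinarith [sq_nonneg (f v)]
    · refine setIntegral_mono_set (hwfi.const_mul _) ?_ Set.inter_subset_left.eventuallyLE
      filter_upwards [ae_restrict_mem hFc.measurableSet] with v hv
      exact mul_nonneg (by positivity) (mul_nonneg (T.weight_nonneg hv.1) (sq_nonneg _))
  rw [T.integral_surface T.gap_zero_barycenter]
  refine h1.trans ((mul_le_mul_of_nonneg_left h2 (by positivity)).trans (le_of_eq ?_))
  simp only [hf, hF, hb]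
  ring

/-- `Y` is the height of `T` over `e`. The center of dilation is the midpoint of `b` and a highest
point: its height is `Y / 2` and its other gaps are at least half those at `b`. After dilation by at
most `1 / 2` each of these `n + 1` factors keeps a quarter of its reference value. -/
theorem exists_height (hd : d ≤ 3) : ∃ Y : ℝ, 0 < Y ∧ (∀ x ∈ T.carrier, T.gap 0 x ≤ Y) ∧
    ∀ (k : ℕ) (u : MvPolynomial (Fin d) ℝ), u.totalDegree ≤ k →
      Y * ∫ x, polyVal u x ^ 2 ∂T.bulk ≤
        2 ^ d * (k + 1) * dilationConst k 2 ^ 2 * 4 ^ (n + 1) *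
          ∫ x, T.gap 0 x * (T.weight x * polyVal u x ^ 2) ∂T.bulk := by
  obtain ⟨z, hz, hmax⟩ := T.isCompact_carrier.exists_isMaxOn
    ⟨_, T.barycenter_mem_carrier⟩ (T.continuous_gap 0).continuousOn
  obtain ⟨x₀, hx₀, hpos⟩ := T.exists_gap_zero_pos
  have hY : 0 < T.gap 0 z := hpos.trans_le (hmax hx₀)
  refine ⟨T.gap 0 z, hY, fun x hx => hmax hx, fun k u hu => ?_⟩
  set Y := T.gap 0 z with hYdef
  set b := T.barycenter with hb
  set a := b + (1 / 2 : ℝ) • (z - b) with ha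
  have hac : a ∈ T.carrier :=
    T.segment_mem_carrier T.barycenter_mem_carrier hz (by norm_num) (by norm_num)
  set K' := T.carrier ∩ ({x | Y / 4 ≤ T.gap 0 x} ∩
    {x | ∀ i : Fin n, 1 / 4 * T.gap i.succ b ≤ T.gap i.succ x}) with hK'
  have hcl : IsClosed {x | ∀ i : Fin n, 1 / 4 * T.gap i.succ b ≤ T.gap i.succ x} := by
    rw [Set.ofPred_forall]
    exact isClosed_iInter fun i => isClosed_le continuous_const (T.continuous_gap _)
  have hK'c : IsCompact K' := T.isCompact_carrier.inter_right
    ((isClosed_le continuous_const (T.continuous_gap 0)).inter hcl)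
  have hmem : ∀ x ∈ T.carrier, ∀ r : ℝ, 0 < r → r ≤ 1 / (2 : ℕ) → a + r • (x - a) ∈ K' := by
    intro x hx r hr hr2
    norm_num at hr2
    refine ⟨T.segment_mem_carrier hac hx hr.le (by linarith), ?_, fun i => ?_⟩
    · show Y / 4 ≤ T.gap 0 _
      rw [gap_segment, ha, gap_segment, T.gap_zero_barycenter]
      have := T.gap_nonneg hx 0
      nlinarith
    · rw [gap_segment, ha, gap_segment]
      have h1 := T.gap_nonneg hx i.succ
      have h2 := T.gap_nonneg hz i.succ
      have h3 := T.gap_barycenter_pos i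
      have h4 : 0 ≤ r * T.gap i.succ x := mul_nonneg hr.le h1
      have h5 : 1 / 2 * T.gap i.succ b ≤
        (1 - 1 / 2) * T.gap i.succ b + 1 / 2 * T.gap i.succ z := by linarith
      have h6 : (1 / 2 : ℝ) * (1 / 2 * T.gap i.succ b) ≤
          (1 - r) * ((1 - 1 / 2) * T.gap i.succ b + 1 / 2 * T.gap i.succ z) := by
        gcongr <;> linarith
      linarith
  have hfin : Module.finrank ℝ (EuclideanSpace ℝ (Fin d)) = d := finrank_euclideanSpace_fin
  have h1 := setIntegral_sq_le_of_dilation (volume : Measure (EuclideanSpace ℝ (Fin d))) k 2 le_rfl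
    a (continuous_polyVal u) (fun x => exists_polynomial_line u hu a (x - a))
    -- In dimension `3` there is one surplus factor `ρ ≤ k + 1`.
    T.isCompact_carrier hK'c hmem (c := (k : ℝ) + 1) (fun j hj => by
      have hjk : (j : ℝ) ≤ k := by exact_mod_cast (by omega : j ≤ k)
      have h1 : 1 ≤ ((k : ℝ) + 1) / (j + 1) := by
        rw [one_le_div (by positivity)]; linarith
      have h2 : ((k : ℝ) + 1) / (j + 1) ≤ k + 1 :=
        div_le_self (by positivity) (by linarith [(Nat.cast_nonneg j : (0 : ℝ) ≤ j)])
      rw [hfin]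
      calc (((k : ℝ) + 1) / (j + 1)) ^ d ≤ (((k : ℝ) + 1) / (j + 1)) ^ 3 :=
            pow_le_pow_right₀ h1 hd
        _ = ((k : ℝ) + 1) / (j + 1) * (((k : ℝ) + 1) / (j + 1)) ^ 2 := by ring
        _ ≤ _ := by gcongr)
  rw [hfin] at h1
  have hIc : Continuous fun x => T.gap 0 x * (T.weight x * polyVal u x ^ 2) :=
    (T.continuous_gap 0).mul (T.continuous_weight.mul ((continuous_polyVal u).pow 2))
  have h2 : Y * ∫ x in K', polyVal u x ^ 2 ≤
      4 ^ (n + 1) * ∫ x, T.gap 0 x * (T.weight x * polyVal u x ^ 2) ∂T.bulk := by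
    rw [← integral_const_mul, ← integral_const_mul]
    refine le_trans (b := ∫ x in K', 4 ^ (n + 1) *
      (T.gap 0 x * (T.weight x * polyVal u x ^ 2))) ?_ ?_
    · refine setIntegral_mono_on
        ((continuous_const.mul ((continuous_polyVal u).pow 2)).continuousOn.integrableOn_compact
          hK'c)
        ((continuous_const.mul hIc).continuousOn.integrableOn_compact hK'c)
        hK'c.measurableSet fun x hx => ?_
      have h3 := T.pow_le_weight (by norm_num) hx.2.2
      have h4 : (1 : ℝ) ≤ 4 ^ n * T.weight x := by
        calc (1 : ℝ) = 4 ^ n * (1 / 4) ^ n := by rw [← mul_pow]; norm_num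
          _ ≤ _ := by gcongr
      have h5 : Y ≤ 4 * T.gap 0 x := by
        have : Y / 4 ≤ T.gap 0 x := hx.2.1
        linarith
      have h6 : Y ≤ 4 ^ (n + 1) * (T.gap 0 x * T.weight x) := by
        rw [pow_succ]
        nlinarith
      calc Y * polyVal u x ^ 2
          ≤ 4 ^ (n + 1) * (T.gap 0 x * T.weight x) * polyVal u x ^ 2 := by gcongr
        _ = _ := by ring
    · refine setIntegral_mono_set
        ((continuous_const.mul hIc).continuousOn.integrableOn_compact T.isCompact_carrier) ?_
        Set.inter_subset_left.eventuallyLE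
      filter_upwards [ae_restrict_mem T.isClosed_carrier.measurableSet] with x hx
      exact mul_nonneg (by positivity) (mul_nonneg (T.gap_nonneg hx 0)
        (mul_nonneg (T.weight_nonneg hx) (sq_nonneg _)))
  have h7 : ∫ x, polyVal u x ^ 2 ∂T.bulk ≤
      2 ^ d * (k + 1) * dilationConst k 2 ^ 2 * ∫ x in K', polyVal u x ^ 2 := by
    simpa [bulk] using h1
  calc Y * ∫ x, polyVal u x ^ 2 ∂T.bulk
      ≤ Y * (2 ^ d * (k + 1) * dilationConst k 2 ^ 2 * ∫ x in K', polyVal u x ^ 2) := by gcongr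
    _ = 2 ^ d * (k + 1) * dilationConst k 2 ^ 2 * (Y * ∫ x in K', polyVal u x ^ 2) := by ring
    _ ≤ 2 ^ d * (k + 1) * dilationConst k 2 ^ 2 * (4 ^ (n + 1) *
          ∫ x, T.gap 0 x * (T.weight x * polyVal u x ^ 2) ∂T.bulk) := by gcongr
    _ = _ := by ring

end ConvexPolytope

/-- The bilinear form `(p, r) ↦ ∫ w p r dμ` on polynomials. -/
noncomputable def weightedForm {d : ℕ} (μ : Measure (EuclideanSpace ℝ (Fin d)))
    (hμ : ∀ f : EuclideanSpace ℝ (Fin d) → ℝ, Continuous f → Integrable f μ)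
    (w : EuclideanSpace ℝ (Fin d) → ℝ) (hw : Continuous w) :
    MvPolynomial (Fin d) ℝ →ₗ[ℝ] MvPolynomial (Fin d) ℝ →ₗ[ℝ] ℝ :=
  have hint : ∀ p r : MvPolynomial (Fin d) ℝ,
      Integrable (fun x => w x * (polyVal p x * polyVal r x)) μ := fun p r =>
    hμ _ (hw.mul ((continuous_polyVal p).mul (continuous_polyVal r)))
  LinearMap.mk₂ ℝ (fun p r => ∫ x, w x * (polyVal p x * polyVal r x) ∂μ)
    (fun p p' r => by
      rw [← integral_add (hint p r) (hint p' r)]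
      exact integral_congr_ae (Filter.Eventually.of_forall fun x => by simp; ring))
    (fun c p r => by
      rw [smul_eq_mul, ← integral_const_mul]
      exact integral_congr_ae (Filter.Eventually.of_forall fun x => by simp; ring))
    (fun p r r' => by
      rw [← integral_add (hint p r) (hint p r')]
      exact integral_congr_ae (Filter.Eventually.of_forall fun x => by simp; ring))
    (fun c p r => by
      rw [smul_eq_mul, ← integral_const_mul]
      exact integral_congr_ae (Filter.Eventually.of_forall fun x => by simp; ring))

/-! ### The factors `λ_i` as polynomials. -/

namespace ConvexPolytope

variable {d n : ℕ} (T : ConvexPolytope d n)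

/-- `gap` as a polynomial. -/
noncomputable def gapPoly (i : Fin (n + 1)) : MvPolynomial (Fin d) ℝ :=
  MvPolynomial.C (T.offset i) - ∑ j, MvPolynomial.C (T.normal i j) * MvPolynomial.X j

theorem polyVal_gapPoly (i : Fin (n + 1)) (x : EuclideanSpace ℝ (Fin d)) :
    polyVal (T.gapPoly i) x = T.gap i x := by
  simp only [gapPoly, polyVal_sub, polyVal_C, polyVal_sum, polyVal_mul, polyVal_X, gap,
    PiLp.inner_apply]
  congr 1
  exact Finset.sum_congr rfl fun j _ => by simp [mul_comm]

theorem totalDegree_gapPoly (i : Fin (n + 1)) : (T.gapPoly i).totalDegree ≤ 1 := by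
  refine (MvPolynomial.totalDegree_sub _ _).trans (max_le (by simp) ?_)
  refine MvPolynomial.totalDegree_finsetSum_le fun j _ => ?_
  refine (MvPolynomial.totalDegree_mul _ _).trans ?_
  simp [MvPolynomial.totalDegree_X]

theorem polyVal_affine {D : MvPolynomial (Fin d) ℝ} (hD : D.totalDegree ≤ 1)
    (a x : EuclideanSpace ℝ (Fin d)) (t : ℝ) :
    polyVal D (a + t • (x - a)) = (1 - t) * polyVal D a + t * polyVal D x := by
  obtain ⟨P, hP, hPe⟩ := exists_polynomial_line D hD a (x - a)
  rw [Polynomial.eq_X_add_C_of_natDegree_le_one hP] at hPe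
  have h0 := hPe 0
  have h1 := hPe 1
  have ht := hPe t
  rw [zero_smul, add_zero] at h0
  rw [one_smul, add_sub_cancel] at h1
  rw [← ht, ← h0, ← h1]
  simp
  ring

/-- The zero set of an affine polynomial is an affine subspace. Here it contains a facet spanning a
hyperplane and a point off that hyperplane, so it is everything. -/
theorem eq_zero_of_vanish_facet {i : Fin n} {D : MvPolynomial (Fin d) ℝ} (hD : D.totalDegree ≤ 1)
    (hf : ∀ x ∈ T.facet i.succ, polyVal D x = 0) (hb : polyVal D T.barycenter = 0) : D = 0 := by
  let Z : AffineSubspace ℝ (EuclideanSpace ℝ (Fin d)) :=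
    { carrier := {x | polyVal D x = 0}
      smul_vsub_vadd_mem' := by
        intro c p₁ p₂ p₃ h1 h2 h3
        have h1' : polyVal D p₁ = 0 := h1
        have h2' : polyVal D p₂ = 0 := h2
        have h3' : polyVal D p₃ = 0 := h3
        -- Reflecting `p₂` in the midpoint of `p₁` and `p₃` gives `p₁ + p₃ - p₂`, still a zero; the
        -- target point lies on the line joining it to `p₃`.
        have hm := polyVal_affine hD p₁ p₃ (1 / 2)
        have hq := polyVal_affine hD p₂ (p₁ + (1 / 2 : ℝ) • (p₃ - p₁)) 2
        have hr := polyVal_affine hD p₃ (p₂ + (2 : ℝ) • (p₁ + (1 / 2 : ℝ) • (p₃ - p₁) - p₂)) c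
        rw [hq, hm, h1', h2', h3'] at hr
        show polyVal D _ = 0
        rw [vsub_eq_sub, vadd_eq_add]
        have e : c • (p₁ - p₂) + p₃ =
            p₃ + c • (p₂ + (2 : ℝ) • (p₁ + (1 / 2 : ℝ) • (p₃ - p₁) - p₂) - p₃) := by module
        rw [e, hr]
        ring }
  obtain ⟨z, hz⟩ : (T.facet i.succ).Nonempty := T.facet_nonempty i.succ
  have hsub : vectorSpan ℝ (T.facet i.succ) ≤ Z.direction := by
    rw [AffineSubspace.direction_eq_vectorSpan]
    exact vectorSpan_mono ℝ fun x hx => hf x hx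
  have hlt : vectorSpan ℝ (T.facet i.succ) < Z.direction := by
    refine lt_of_le_of_ne hsub fun heq => ?_
    have hmem : T.barycenter - z ∈ Z.direction :=
      AffineSubspace.vsub_mem_direction (s := Z) hb (hf z hz)
    rw [← heq] at hmem
    have hle : vectorSpan ℝ (T.facet i.succ) ≤ (ℝ ∙ T.normal i.succ)ᗮ := by
      rw [vectorSpan_def, Submodule.span_le]
      rintro _ ⟨y, hy, y', hy', rfl⟩
      rw [SetLike.mem_coe, Submodule.mem_orthogonal_singleton_iff_inner_right]
      have h1 := hy.2
      have h2 := hy'.2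
      simp only [vsub_eq_sub, inner_sub_right]
      linarith
    have h1 := Submodule.mem_orthogonal_singleton_iff_inner_right.1 (hle hmem)
    have h2 := hz.2
    have h3 := T.gap_barycenter_pos i
    simp only [gap] at h3
    rw [inner_sub_right] at h1
    linarith
  have h1 := Submodule.finrank_lt_finrank_of_lt hlt
  have h2 : Module.finrank ℝ (vectorSpan ℝ (T.facet i.succ)) + 1 = d := T.facet_dim i.succ
  have h3 : Z.direction = ⊤ := by
    apply Submodule.eq_top_of_finrank_eq
    have := Submodule.finrank_le Z.direction
    rw [finrank_euclideanSpace_fin] at this ⊢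
    omega
  refine polyVal_ext fun x => ?_
  have hx : x - z ∈ Z.direction := by rw [h3]; trivial
  have h4 : (x - z) +ᵥ z ∈ Z := AffineSubspace.vadd_mem_of_mem_direction hx (hf z hz)
  rw [vadd_eq_add, sub_add_cancel] at h4
  rw [polyVal_zero]
  exact h4

theorem isFaceFactor_gapPoly (i : Fin n) :
    T.IsFaceFactor i ((T.gap i.succ T.barycenter)⁻¹ • T.gapPoly i.succ) := by
  refine ⟨(MvPolynomial.totalDegree_smul_le _ _).trans (T.totalDegree_gapPoly _), fun x hx => ?_, ?_⟩
  · rw [polyVal_smul, polyVal_gapPoly, (T.mem_facet_iff.1 hx).2, mul_zero]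
  · rw [polyVal_smul, polyVal_gapPoly, inv_mul_cancel₀ (T.gap_barycenter_pos i).ne']

theorem IsFaceFactor.eq {T : ConvexPolytope d n} {i : Fin n} {l l' : MvPolynomial (Fin d) ℝ}
    (h : T.IsFaceFactor i l) (h' : T.IsFaceFactor i l') : l = l' := by
  rw [← sub_eq_zero]
  refine T.eq_zero_of_vanish_facet (i := i)
    ((MvPolynomial.totalDegree_sub _ _).trans (max_le h.1 h'.1)) (fun x hx => ?_) ?_
  · rw [polyVal_sub, h.2.1 x hx, h'.2.1 x hx, sub_zero]
  · rw [polyVal_sub, h.2.2, h'.2.2, sub_self]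

theorem existsUnique_isFaceFactor (i : Fin n) : ∃! l, T.IsFaceFactor i l :=
  ⟨_, T.isFaceFactor_gapPoly i, fun _ h => h.eq (T.isFaceFactor_gapPoly i)⟩

theorem polyVal_prod_faceFactor {lam : Fin n → MvPolynomial (Fin d) ℝ}
    (h : ∀ i, T.IsFaceFactor i (lam i)) (x : EuclideanSpace ℝ (Fin d)) :
    polyVal (∏ i, lam i) x = T.weight x := by
  rw [polyVal_prod, weight]
  refine Finset.prod_congr rfl fun i _ => ?_
  rw [(h i).eq (T.isFaceFactor_gapPoly i), polyVal_smul, polyVal_gapPoly, div_eq_inv_mul]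

/-! ### Stability estimate, existence and uniqueness of the lifting. -/

theorem integral_sq_surface_le (hd : d ≤ 3) (k : ℕ) {p : MvPolynomial (Fin d) ℝ}
    (hp : p.totalDegree ≤ k) :
    ∫ x, polyVal p x ^ 2 ∂T.surface ≤ 2 ^ n * (2 ^ (d - 1) * dilationConst k 2 ^ 2) *
      ∫ x, T.weight x * polyVal p x ^ 2 ∂T.surface := by
  have h := T.setIntegral_sq_le_surface hd k 2 le_rfl hp (T.isCompact_footprint T.barycenter)
    (fun v hv r hr hr2 => by
      have := (T.convex_footprint T.barycenter) (interior_subset T.zero_mem_interior_footprint) hv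
        (a := 1 - r) (b := r) (by norm_num at hr2; linarith) hr.le (by ring)
      simpa using this)
  rw [T.integral_surface T.gap_zero_barycenter]
  exact_mod_cast h

/-- Passing from radius `h_T` to `h_T / 8` requires ratio `2 / M = 1 / 8`, hence `M = 16`. -/
theorem integral_sq_ball_le (hd : d ≤ 3) (k : ℕ)
    (hball : Metric.closedBall (0 : T.tangent) (T.size / 8) ⊆ T.footprint T.barycenter)
    {p : MvPolynomial (Fin d) ℝ} (hp : p.totalDegree ≤ k) :
    ∫ v in Metric.closedBall (0 : T.tangent) T.size,
        polyVal p (T.barycenter + (v : EuclideanSpace ℝ (Fin d))) ^ 2 ≤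
      2 ^ n * (16 ^ (d - 1) * dilationConst k 16 ^ 2) *
        ∫ x, T.weight x * polyVal p x ^ 2 ∂T.surface := by
  have h := T.setIntegral_sq_le_surface hd k 16 (by norm_num) hp
    (isCompact_closedBall (0 : T.tangent) T.size)
    (fun v hv r hr hr2 => by
      apply hball
      rw [mem_closedBall_zero_iff] at hv ⊢
      rw [norm_smul, Real.norm_eq_abs, abs_of_pos hr]
      have h8 : r ≤ 1 / 8 := by norm_num at hr2; linarith
      calc r * ‖v‖ ≤ 1 / 8 * T.size := by gcongr
        _ = _ := by ring)
  exact_mod_cast h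

/-- The constant of the bound of the lifting in terms of a bound `W` of the factors on `T`. -/
noncomputable def _root_.liftBound (d n k : ℕ) (W : ℝ) : ℝ :=
  W ^ (2 * n) * (2 ^ n * (2 ^ (d - 1) * dilationConst k 2 ^ 2)) *
    (2 ^ n * (16 ^ (d - 1) * dilationConst k 16 ^ 2)) *
    (if k = 0 then 1
      else 2 * (1 + W ^ n * (2 ^ d * k * dilationConst (k - 1) 2 ^ 2 * 4 ^ (n + 1))))

theorem _root_.integral_sq_add_le {Ω : Type*} [MeasurableSpace Ω] {μ : Measure Ω}
    {f g : Ω → ℝ} (hfg : Integrable (fun x => (f x + g x) ^ 2) μ)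
    (hf : Integrable (fun x => f x ^ 2) μ) (hg : Integrable (fun x => g x ^ 2) μ) :
    ∫ x, (f x + g x) ^ 2 ∂μ ≤ 2 * (∫ x, f x ^ 2 ∂μ) + 2 * ∫ x, g x ^ 2 ∂μ := by
  rw [← integral_const_mul, ← integral_const_mul,
    ← integral_add (hf.const_mul _) (hg.const_mul _)]
  refine integral_mono hfg ((hf.const_mul _).add (hg.const_mul _)) fun x => ?_
  simp only []
  nlinarith [sq_nonneg (f x - g x)]

/-- The norm of `w y u`, where `y u` is the part of the factor that vanishes on `e`. -/
theorem integral_sq_correction_le (hd : d ≤ 3) {W : ℝ} (hW0 : 0 ≤ W)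
    (hW : ∀ x ∈ T.carrier, ∀ i : Fin n, T.gap i.succ x ≤ W * T.gap i.succ T.barycenter)
    {k : ℕ} {u : MvPolynomial (Fin d) ℝ} (hu : u.totalDegree ≤ k)
    {g : EuclideanSpace ℝ (Fin d) → ℝ} (hg : Continuous g)
    (horth : ∫ x, T.weight x * ((g x + T.gap 0 x * polyVal u x) * polyVal u x) ∂T.bulk = 0) :
    ∫ x, (T.weight x * (T.gap 0 x * polyVal u x)) ^ 2 ∂T.bulk ≤
      W ^ (2 * n) * (W ^ n * (2 ^ d * (k + 1) * dilationConst k 2 ^ 2 * 4 ^ (n + 1))) *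
        ∫ x, g x ^ 2 ∂T.bulk := by
  obtain ⟨Y, hY, hYle, hYu⟩ := T.exists_height hd
  have hc := hYu k u hu
  set c := 2 ^ d * ((k : ℝ) + 1) * dilationConst k 2 ^ 2 * 4 ^ (n + 1) with hcdef
  have hc0 : 0 ≤ c := by positivity
  have huc := continuous_polyVal u
  have hwc := T.continuous_weight
  have hyc := T.continuous_gap 0
  set I := ∫ x, T.gap 0 x * (T.weight x * polyVal u x ^ 2) ∂T.bulk with hI
  set U := ∫ x, polyVal u x ^ 2 ∂T.bulk with hU
  set G := ∫ x, g x ^ 2 ∂T.bulk with hG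
  have hI0 : 0 ≤ I := integral_nonneg_of_ae (T.ae_bulk fun x hx =>
    mul_nonneg (T.gap_nonneg hx 0) (mul_nonneg (T.weight_nonneg hx) (sq_nonneg _)))
  have hG0 : 0 ≤ G := integral_nonneg fun x => sq_nonneg _
  have hU0 : 0 ≤ U := integral_nonneg fun x => sq_nonneg _
  have hWn : 0 ≤ W ^ n := pow_nonneg hW0 n
  have hwsq : ∀ f : EuclideanSpace ℝ (Fin d) → ℝ, Continuous f →
      ∫ x, T.weight x * f x ^ 2 ∂T.bulk ≤ W ^ n * ∫ x, f x ^ 2 ∂T.bulk := by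
    intro f hf
    rw [← integral_const_mul]
    refine integral_mono_ae (T.integrable_bulk (hwc.mul (hf.pow 2)))
      ((T.integrable_bulk (hf.pow 2)).const_mul _) (T.ae_bulk fun x hx => ?_)
    exact mul_le_mul_of_nonneg_right (T.weight_le hW hx) (sq_nonneg _)
  -- The orthogonality is tested with `u` itself, which is admissible since its degree is below that
  -- of the factor.
  have hIeq : ∫ x, T.weight x * (g x * polyVal u x) ∂T.bulk = - I := by
    have i1 : Integrable (fun x => T.weight x * (g x * polyVal u x)) T.bulk :=
      T.integrable_bulk (hwc.mul (hg.mul huc))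
    have i2 : Integrable (fun x => T.gap 0 x * (T.weight x * polyVal u x ^ 2)) T.bulk :=
      T.integrable_bulk (hyc.mul (hwc.mul (huc.pow 2)))
    rw [eq_neg_iff_add_eq_zero, hI, ← integral_add i1 i2, ← horth]
    exact integral_congr_ae (Filter.Eventually.of_forall fun x => by simp only []; ring)
  have hcs := integral_mul_sq_le_of_weight (μ := T.bulk) (w := T.weight) (f := g)
    (g := polyVal u) (T.ae_bulk fun x hx => T.weight_nonneg hx)
    (T.integrable_bulk (hwc.mul (hg.pow 2))) (T.integrable_bulk (hwc.mul (hg.mul huc)))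
    (T.integrable_bulk (hwc.mul (huc.pow 2)))
  rw [hIeq, neg_sq] at hcs
  have hI2 : I ^ 2 ≤ (W ^ n * G) * (W ^ n * U) := by
    refine hcs.trans (mul_le_mul (hwsq g hg) (hwsq _ huc) ?_ (by positivity))
    exact integral_nonneg_of_ae (T.ae_bulk fun x hx =>
      mul_nonneg (T.weight_nonneg hx) (sq_nonneg _))
  -- `Y U ≤ c I` turns the Cauchy–Schwarz bound for `I ^ 2` into a bound linear in `I`. The height
  -- `Y` appears here and in the final estimate in such a way that it drops out.
  have hYI : Y * I ≤ W ^ n * W ^ n * c * G := by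
    rcases hI0.eq_or_lt with h0 | hpos
    · rw [← h0, mul_zero]; positivity
    · have h1 : Y * I ^ 2 ≤ W ^ n * W ^ n * c * G * I := by
        calc Y * I ^ 2 ≤ Y * ((W ^ n * G) * (W ^ n * U)) := by gcongr
          _ = W ^ n * W ^ n * G * (Y * U) := by ring
          _ ≤ W ^ n * W ^ n * G * (c * I) := by gcongr
          _ = _ := by ring
      exact le_of_mul_le_mul_right (by linarith [h1, sq I, mul_assoc Y I I]) hpos
  have hle : ∫ x, (T.weight x * (T.gap 0 x * polyVal u x)) ^ 2 ∂T.bulk ≤ W ^ n * Y * I := by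
    rw [hI, ← integral_const_mul]
    refine integral_mono_ae (T.integrable_bulk ((hwc.mul (hyc.mul huc)).pow 2))
      ((T.integrable_bulk (hyc.mul (hwc.mul (huc.pow 2)))).const_mul _) (T.ae_bulk fun x hx => ?_)
    have h1 := T.weight_le hW hx
    have h2 := T.weight_nonneg hx
    have h3 := T.gap_nonneg hx 0
    have h4 := hYle x hx
    calc (T.weight x * (T.gap 0 x * polyVal u x)) ^ 2
        = T.weight x * T.gap 0 x * (T.gap 0 x * (T.weight x * polyVal u x ^ 2)) := by ring
      _ ≤ W ^ n * Y * (T.gap 0 x * (T.weight x * polyVal u x ^ 2)) := by gcongr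
  calc _ ≤ W ^ n * Y * I := hle
    _ = W ^ n * (Y * I) := by ring
    _ ≤ W ^ n * (W ^ n * W ^ n * c * G) := by gcongr
    _ = _ := by rw [two_mul n, pow_add]; ring

theorem integral_sq_lift_le (hd : d ≤ 3)
    (hball : Metric.closedBall (0 : T.tangent) (T.size / 8) ⊆ T.footprint T.barycenter)
    {W : ℝ} (hW0 : 0 ≤ W)
    (hW : ∀ x ∈ T.carrier, ∀ i : Fin n, T.gap i.succ x ≤ W * T.gap i.succ T.barycenter)
    {k : ℕ} {q₀ q₁ : MvPolynomial (Fin d) ℝ} (hq₁ : q₁.totalDegree ≤ k)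
    (h1 : ∫ x, T.weight x * polyVal q₁ x ^ 2 ∂T.surface =
      ∫ x, polyVal q₀ x * polyVal q₁ x ∂T.surface)
    (h2 : ∀ p : MvPolynomial (Fin d) ℝ, p.totalDegree + 1 ≤ k →
      ∫ x, T.weight x * (polyVal q₁ x * polyVal p x) ∂T.bulk = 0) :
    ∫ x, (T.weight x * polyVal q₁ x) ^ 2 ∂T.bulk ≤
      T.size * liftBound d n k W * ∫ x, polyVal q₀ x ^ 2 ∂T.surface := by
  have hq₁c := continuous_polyVal q₁
  have hq₀c := continuous_polyVal q₀
  have hwc := T.continuous_weight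
  have hyc := T.continuous_gap 0
  set A := ∫ x, T.weight x * polyVal q₁ x ^ 2 ∂T.surface with hA
  set Q := ∫ x, polyVal q₀ x ^ 2 ∂T.surface with hQ
  have hA0 : 0 ≤ A := integral_nonneg_of_ae (T.ae_surface fun x hx =>
    mul_nonneg (T.weight_nonneg hx) (sq_nonneg _))
  have hQ0 : 0 ≤ Q := integral_nonneg fun x => sq_nonneg _
  set c₁ : ℝ := 2 ^ n * (2 ^ (d - 1) * dilationConst k 2 ^ 2) with hc₁
  set c₂ : ℝ := 2 ^ n * (16 ^ (d - 1) * dilationConst k 16 ^ 2) with hc₂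
  have hc₁0 : 0 ≤ c₁ := by positivity
  have hc₂0 : 0 ≤ c₂ := by positivity
  -- Cauchy–Schwarz gives `A² ≤ Q ∫_e q₁²`, and the last integral is at most `c₁ A`.
  have hAQ : A ≤ c₁ * Q := by
    have hP : ∫ x, polyVal q₁ x ^ 2 ∂T.surface ≤ c₁ * A := T.integral_sq_surface_le hd k hq₁
    have hcs := integral_mul_sq_le_of_weight (μ := T.surface) (w := fun _ => 1)
      (f := polyVal q₀) (g := polyVal q₁) (Filter.Eventually.of_forall fun _ => zero_le_one)
      (T.integrable_surface (continuous_const.mul (hq₀c.pow 2)))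
      (T.integrable_surface (continuous_const.mul (hq₀c.mul hq₁c)))
      (T.integrable_surface (continuous_const.mul (hq₁c.pow 2)))
    simp only [one_mul] at hcs
    rw [← h1] at hcs
    rcases hA0.eq_or_lt with h0 | hpos
    · rw [← h0]; positivity
    · have : A ^ 2 ≤ Q * (c₁ * A) := hcs.trans (by gcongr)
      nlinarith
  set g : EuclideanSpace ℝ (Fin d) → ℝ := fun x => polyVal q₁ (x + T.gap 0 x • T.normal 0) with hg
  have hgc : Continuous g := hq₁c.comp (by fun_prop)
  set G := ∫ x, g x ^ 2 ∂T.bulk with hG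
  have hG0 : 0 ≤ G := integral_nonneg fun x => sq_nonneg _
  have hGQ : G ≤ T.size * (c₂ * (c₁ * Q)) := by
    have h3 : G ≤ T.size * ∫ v in Metric.closedBall (0 : T.tangent) T.size,
        polyVal q₁ (T.barycenter + (v : EuclideanSpace ℝ (Fin d))) ^ 2 :=
      T.setIntegral_proj_le (f := fun x => polyVal q₁ x ^ 2) (hq₁c.pow 2) fun x => sq_nonneg _
    have h4 := T.integral_sq_ball_le hd k hball hq₁
    have hh := T.size_pos
    refine h3.trans (mul_le_mul_of_nonneg_left (h4.trans ?_) hh.le)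
    gcongr
  have hwg : ∫ x, (T.weight x * g x) ^ 2 ∂T.bulk ≤ W ^ (2 * n) * G := by
    rw [hG, ← integral_const_mul]
    refine integral_mono_ae (T.integrable_bulk ((hwc.mul hgc).pow 2))
      ((T.integrable_bulk (hgc.pow 2)).const_mul _) (T.ae_bulk fun x hx => ?_)
    have h5 : T.weight x ^ 2 ≤ (W ^ n) ^ 2 :=
      pow_le_pow_left₀ (T.weight_nonneg hx) (T.weight_le hW hx) 2
    calc (T.weight x * g x) ^ 2 = T.weight x ^ 2 * g x ^ 2 := mul_pow _ _ _
      _ ≤ (W ^ n) ^ 2 * g x ^ 2 := by gcongr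
      _ = _ := by rw [← pow_mul, mul_comm n 2]
  -- For `k = 0` the correction `y u` is absent; otherwise the `2` comes from `(a + b)² ≤ 2 a² + 2
  -- b²`.
  set R : ℝ := (if k = 0 then 1
      else 2 * (1 + W ^ n * (2 ^ d * k * dilationConst (k - 1) 2 ^ 2 * 4 ^ (n + 1)))) with hR
  have hR1 : 1 ≤ R := by
    rw [hR]
    split_ifs
    · exact le_rfl
    · have : 0 ≤ W ^ n * (2 ^ d * (k : ℝ) * dilationConst (k - 1) 2 ^ 2 * 4 ^ (n + 1)) := by
        positivity
      linarith
  have hmain : ∫ x, (T.weight x * polyVal q₁ x) ^ 2 ∂T.bulk ≤ W ^ (2 * n) * R * G := by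
    obtain ⟨u, hu, hux⟩ := exists_polyVal_eq_proj_add (T.normal 0) (T.gapPoly 0)
      (T.totalDegree_gapPoly 0) k q₁ hq₁
    simp only [polyVal_gapPoly] at hux
    by_cases hu0 : u = 0
    · have : ∀ x, polyVal q₁ x = g x := fun x => by rw [hux x, hu0, polyVal_zero, mul_zero, add_zero]
      simp_rw [this]
      refine hwg.trans ?_
      have : 0 ≤ W ^ (2 * n) := by positivity
      calc W ^ (2 * n) * G = W ^ (2 * n) * 1 * G := by ring
        _ ≤ _ := by gcongr
    · have hud : u.totalDegree + 1 ≤ k := hu.resolve_left hu0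
      have hk : k ≠ 0 := by omega
      obtain ⟨l, rfl⟩ := Nat.exists_eq_succ_of_ne_zero hk
      have horth := h2 u hud
      have hq : ∀ x, polyVal q₁ x = g x + T.gap 0 x * polyVal u x := hux
      simp_rw [hq] at horth ⊢
      have huc := continuous_polyVal u
      have hcor := T.integral_sq_correction_le hd hW0 hW (k := l) (by omega) hgc horth
      have hsum := integral_sq_add_le (μ := T.bulk) (f := fun x => T.weight x * g x)
        (g := fun x => T.weight x * (T.gap 0 x * polyVal u x))
        (T.integrable_bulk (((hwc.mul hgc).add (hwc.mul (hyc.mul huc))).pow 2))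
        (T.integrable_bulk ((hwc.mul hgc).pow 2))
        (T.integrable_bulk ((hwc.mul (hyc.mul huc)).pow 2))
      simp_rw [mul_add]
      refine hsum.trans ?_
      rw [hR, if_neg hk]
      simp only [Nat.succ_eq_add_one, Nat.add_sub_cancel]
      push_cast
      linarith
  have hWn : 0 ≤ W ^ (2 * n) := by positivity
  calc _ ≤ W ^ (2 * n) * R * G := hmain
    _ ≤ W ^ (2 * n) * R * (T.size * (c₂ * (c₁ * Q))) := by gcongr
    _ = _ := by rw [liftBound]; ring

/-- The conditions on `e` are solved first. Adding a multiple of `y`, which vanishes on `e`, then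
adjusts the conditions on `T` without disturbing them. -/
theorem exists_lift_factor (hd : d ≤ 3) (k : ℕ) (q₀ : MvPolynomial (Fin d) ℝ) :
    ∃ q₁ : MvPolynomial (Fin d) ℝ, q₁.totalDegree ≤ k ∧
      (∀ p : MvPolynomial (Fin d) ℝ, p.totalDegree ≤ k →
        ∫ x, T.weight x * (polyVal q₁ x * polyVal p x) ∂T.surface =
          ∫ x, polyVal q₀ x * polyVal p x ∂T.surface) ∧
      ∀ p : MvPolynomial (Fin d) ℝ, p.totalDegree + 1 ≤ k →
        ∫ x, T.weight x * (polyVal q₁ x * polyVal p x) ∂T.bulk = 0 := by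
  have hwc := T.continuous_weight
  have hyc := T.continuous_gap 0
  have hsurf : ∃ q₁ : MvPolynomial (Fin d) ℝ, q₁.totalDegree ≤ k ∧
      ∀ p : MvPolynomial (Fin d) ℝ, p.totalDegree ≤ k →
        ∫ x, T.weight x * (polyVal q₁ x * polyVal p x) ∂T.surface =
          ∫ x, polyVal q₀ x * polyVal p x ∂T.surface := by
    set X := MvPolynomial.restrictTotalDegree (Fin d) ℝ k
    set B := weightedForm T.surface (fun f hf => T.integrable_surface hf) T.weight hwc
    set L := weightedForm T.surface (fun f hf => T.integrable_surface hf) (fun _ => 1)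
      continuous_const q₀
    obtain ⟨y, hy⟩ := exists_forall_apply_eq (B.domRestrict₁₂ X X) (L.domRestrict X) (by
      rintro ⟨p, hp⟩ h0
      have hp' : p.totalDegree ≤ k := (MvPolynomial.mem_restrictTotalDegree _ _ _).1 hp
      have h0' : ∫ x, T.weight x * (polyVal p x * polyVal p x) ∂T.surface = 0 := h0
      show ∫ x, 1 * (polyVal q₀ x * polyVal p x) ∂T.surface = 0
      have hpc := continuous_polyVal p
      have hqc := continuous_polyVal q₀
      have h1 := T.integral_sq_surface_le hd k hp'
      simp only [← sq] at h0'
      rw [h0', mul_zero] at h1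
      have hcs := integral_mul_sq_le_of_weight (μ := T.surface) (w := fun _ => 1)
        (f := polyVal q₀) (g := polyVal p) (Filter.Eventually.of_forall fun _ => zero_le_one)
        (T.integrable_surface (continuous_const.mul (hqc.pow 2)))
        (T.integrable_surface (continuous_const.mul (hqc.mul hpc)))
        (T.integrable_surface (continuous_const.mul (hpc.pow 2)))
      have h2 : ∫ x, 1 * polyVal p x ^ 2 ∂T.surface ≤ 0 := by simpa using h1
      have h3 : 0 ≤ ∫ x, 1 * polyVal q₀ x ^ 2 ∂T.surface :=
        integral_nonneg fun x => by positivity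
      nlinarith)
    refine ⟨y, (MvPolynomial.mem_restrictTotalDegree _ _ _).1 y.2, fun p hp => ?_⟩
    have := hy ⟨p, (MvPolynomial.mem_restrictTotalDegree _ _ _).2 hp⟩
    change ∫ x, T.weight x * (polyVal (y : MvPolynomial (Fin d) ℝ) x * polyVal p x) ∂T.surface =
      ∫ x, 1 * (polyVal q₀ x * polyVal p x) ∂T.surface at this
    simpa using this
  obtain ⟨q, hq, hqs⟩ := hsurf
  rcases Nat.eq_zero_or_pos k with rfl | hk
  · exact ⟨q, hq, hqs, fun p hp => by omega⟩
  obtain ⟨l, rfl⟩ : ∃ l, k = l + 1 := ⟨k - 1, by omega⟩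
  set X := MvPolynomial.restrictTotalDegree (Fin d) ℝ l
  set B := weightedForm T.bulk (fun f hf => T.integrable_bulk hf)
    (fun x => T.gap 0 x * T.weight x) (hyc.mul hwc)
  set L := weightedForm T.bulk (fun f hf => T.integrable_bulk hf) T.weight hwc q
  have hqc := continuous_polyVal q
  -- If `∫ y w u² = 0`, then `exists_height` forces `∫ u² = 0`, and the right-hand side vanishes at
  -- `u` by Cauchy–Schwarz.
  obtain ⟨y, hy⟩ := exists_forall_apply_eq (B.domRestrict₁₂ X X) (-(L.domRestrict X)) (by
    rintro ⟨u, hu⟩ h0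
    have hu' : u.totalDegree ≤ l := (MvPolynomial.mem_restrictTotalDegree _ _ _).1 hu
    have h0' : ∫ x, T.gap 0 x * T.weight x * (polyVal u x * polyVal u x) ∂T.bulk = 0 := h0
    have huc := continuous_polyVal u
    suffices ∫ x, T.weight x * (polyVal q x * polyVal u x) ∂T.bulk = 0 by
      change - ∫ x, T.weight x * (polyVal q x * polyVal u x) ∂T.bulk = 0
      rw [this, neg_zero]
    obtain ⟨Y, hY, -, hYu⟩ := T.exists_height hd
    have h1 := hYu l u hu'
    have e : ∫ x, T.gap 0 x * (T.weight x * polyVal u x ^ 2) ∂T.bulk = 0 := by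
      rw [← h0']
      exact integral_congr_ae (Filter.Eventually.of_forall fun x => by simp only []; ring)
    rw [e, mul_zero] at h1
    have hU0 : 0 ≤ ∫ x, polyVal u x ^ 2 ∂T.bulk := integral_nonneg fun x => sq_nonneg _
    have hU : ∫ x, polyVal u x ^ 2 ∂T.bulk = 0 := by nlinarith
    have hcs := integral_mul_sq_le_of_weight (μ := T.bulk) (w := fun _ => 1)
      (f := fun x => T.weight x * polyVal q x) (g := polyVal u)
      (Filter.Eventually.of_forall fun _ => zero_le_one)
      (T.integrable_bulk (continuous_const.mul ((hwc.mul hqc).pow 2)))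
      (T.integrable_bulk (continuous_const.mul ((hwc.mul hqc).mul huc)))
      (T.integrable_bulk (continuous_const.mul (huc.pow 2)))
    simp only [one_mul, hU, mul_zero] at hcs
    simp only [← mul_assoc]
    nlinarith)
  have hyd : (y : MvPolynomial (Fin d) ℝ).totalDegree ≤ l :=
    (MvPolynomial.mem_restrictTotalDegree _ _ _).1 y.2
  have hycon := continuous_polyVal (y : MvPolynomial (Fin d) ℝ)
  refine ⟨q + T.gapPoly 0 * (y : MvPolynomial (Fin d) ℝ), ?_, fun p hp => ?_, fun p hp => ?_⟩
  · refine (MvPolynomial.totalDegree_add _ _).trans (max_le hq ?_)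
    refine (MvPolynomial.totalDegree_mul _ _).trans ?_
    have := T.totalDegree_gapPoly 0
    omega
  · rw [← hqs p hp]
    refine integral_congr_ae ((ae_restrict_mem (T.isClosed_facet 0).measurableSet).mono
      fun x hx => ?_)
    simp only [polyVal_add, polyVal_mul, polyVal_gapPoly, (T.mem_facet_iff.1 hx).2, zero_mul,
      add_zero]
  · have hpc := continuous_polyVal p
    have h1 := hy ⟨p, (MvPolynomial.mem_restrictTotalDegree _ _ _).2 (by omega)⟩
    change ∫ x, T.gap 0 x * T.weight x * (polyVal (y : MvPolynomial (Fin d) ℝ) x * polyVal p x)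
      ∂T.bulk = - ∫ x, T.weight x * (polyVal q x * polyVal p x) ∂T.bulk at h1
    have i1 : Integrable (fun x => T.gap 0 x * T.weight x *
        (polyVal (y : MvPolynomial (Fin d) ℝ) x * polyVal p x)) T.bulk :=
      T.integrable_bulk ((hyc.mul hwc).mul (hycon.mul hpc))
    have i2 : Integrable (fun x => T.weight x * (polyVal q x * polyVal p x)) T.bulk :=
      T.integrable_bulk (hwc.mul (hqc.mul hpc))
    rw [eq_neg_iff_add_eq_zero, ← integral_add i1 i2] at h1
    rw [← h1]
    refine integral_congr_ae (Filter.Eventually.of_forall fun x => ?_)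
    simp only [polyVal_add, polyVal_mul, polyVal_gapPoly]
    ring

theorem eq_zero_of_integral_sq_le_zero {p : MvPolynomial (Fin d) ℝ}
    (h : ∫ x, polyVal p x ^ 2 ∂T.bulk ≤ 0) : p = 0 := by
  have hpc := continuous_polyVal p
  have h0 : ∫ x, polyVal p x ^ 2 ∂T.bulk = 0 :=
    le_antisymm h (integral_nonneg fun x => sq_nonneg _)
  rw [integral_eq_zero_iff_of_nonneg (fun x => sq_nonneg _) (T.integrable_bulk (hpc.pow 2))] at h0
  have hU : IsOpen (interior T.carrier) := isOpen_interior
  have h1 : (fun x => polyVal p x ^ 2) =ᵐ[volume.restrict (interior T.carrier)] fun _ => 0 :=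
    ae_mono (Measure.restrict_mono interior_subset le_rfl) h0
  have h2 := Measure.eqOn_open_of_ae_eq h1 hU (hpc.pow 2).continuousOn continuousOn_const
  refine eq_zero_of_polyVal_eq_zero (U := interior T.carrier) ?_ fun x hx => ?_
  · rw [interior_interior]; exact T.interior_nonempty
  · exact pow_eq_zero_iff (two_ne_zero) |>.1 (h2 hx)

end ConvexPolytope

/-! ### Comparison with the explicit constant. -/

theorem two_pow_succ_sub_one_le (k : ℕ) : (2 : ℝ) ^ (k + 1) - 1 ≤ 3 ^ k := by
  induction k with
  | zero => norm_num
  | succ k ih =>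
    have : (1 : ℝ) ≤ 3 ^ k := one_le_pow₀ (by norm_num)
    rw [pow_succ, pow_succ (3 : ℝ)]
    linarith

theorem dilationConst_two_le (k : ℕ) : dilationConst k 2 ≤ 12 ^ k := by
  have h1 := two_pow_succ_sub_one_le k
  have h2 : ((2 * (k + 1) - 1).choose (k + 1) : ℝ) ≤ 4 ^ k := by
    rw [show 2 * (k + 1) - 1 = 2 * k + 1 by omega, Nat.choose_symm_half]
    exact_mod_cast Nat.choose_middle_le_pow k
  calc dilationConst k 2
      = (2 ^ (k + 1) - 1) * ((2 * (k + 1) - 1).choose (k + 1) : ℝ) := by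
        rw [dilationConst]; norm_num
    _ ≤ 3 ^ k * 4 ^ k := by gcongr
    _ = 12 ^ k := by rw [← mul_pow]; norm_num

/-- Each induction step multiplies the quotient by `(1 + 1 / (k + 1)) ^ (k + 1) ≤ exp 1 < 3`. -/
theorem succ_pow_succ_le (k : ℕ) : ((k : ℝ) + 1) ^ (k + 1) ≤ 3 ^ k * (k + 1).factorial := by
  induction k with
  | zero => norm_num
  | succ k ih =>
    have hk : (0 : ℝ) < (k : ℝ) + 1 := by positivity
    have h1 : (1 + 1 / ((k : ℝ) + 1)) ^ (k + 1) ≤ 3 := by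
      have h2 : 1 + 1 / ((k : ℝ) + 1) ≤ Real.exp (1 / ((k : ℝ) + 1)) := by
        rw [add_comm]; exact Real.add_one_le_exp _
      calc (1 + 1 / ((k : ℝ) + 1)) ^ (k + 1) ≤ Real.exp (1 / ((k : ℝ) + 1)) ^ (k + 1) := by gcongr
        _ = Real.exp 1 := by
          rw [← Real.exp_nat_mul]; congr 1; push_cast; field_simp
        _ ≤ 3 := by linarith [Real.exp_one_lt_d9]
    have h3 : ((k : ℝ) + 2) ^ (k + 1) ≤ 3 * ((k : ℝ) + 1) ^ (k + 1) := by
      have : (k : ℝ) + 2 = (1 + 1 / ((k : ℝ) + 1)) * ((k : ℝ) + 1) := by field_simp; ring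
      rw [this, mul_pow]
      gcongr
    rw [Nat.factorial_succ]
    push_cast
    calc ((k : ℝ) + 1 + 1) ^ (k + 1 + 1) = ((k : ℝ) + 2) ^ (k + 1) * ((k : ℝ) + 2) := by ring
      _ ≤ 3 * ((k : ℝ) + 1) ^ (k + 1) * ((k : ℝ) + 2) := by gcongr
      _ ≤ 3 * (3 ^ k * (k + 1).factorial) * ((k : ℝ) + 2) := by gcongr
      _ = _ := by ring

theorem dilationConst_sixteen_le (k : ℕ) : dilationConst k 16 ≤ 16 / 15 * 144 ^ k := by
  have h1 := two_pow_succ_sub_one_le k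
  have h2 : ((16 * (k + 1) - 1).choose (k + 1) : ℝ) ≤ 16 * 48 ^ k := by
    have hf : (0 : ℝ) < (k + 1).factorial := by exact_mod_cast Nat.factorial_pos _
    refine (Nat.choose_le_pow_div (k + 1) (16 * (k + 1) - 1)).trans ?_
    rw [div_le_iff₀ hf]
    calc ((16 * (k + 1) - 1 : ℕ) : ℝ) ^ (k + 1) ≤ (16 * ((k : ℝ) + 1)) ^ (k + 1) := by
          gcongr
          exact_mod_cast Nat.sub_le _ _
      _ = 16 ^ (k + 1) * ((k : ℝ) + 1) ^ (k + 1) := mul_pow _ _ _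
      _ ≤ 16 ^ (k + 1) * (3 ^ k * (k + 1).factorial) := by
          gcongr; exact succ_pow_succ_le k
      _ = 16 * 48 ^ k * (k + 1).factorial := by
          rw [show (48 : ℝ) = 16 * 3 by norm_num, mul_pow]; ring
  calc dilationConst k 16
      = (2 ^ (k + 1) - 1) * ((16 * (k + 1) - 1).choose (k + 1) : ℝ) / 15 := by
        rw [dilationConst]; norm_num
    _ ≤ 3 ^ k * (16 * 48 ^ k) / 15 := by gcongr
    _ = 16 / 15 * (3 * 48) ^ k := by rw [mul_pow]; ring
    _ = _ := by norm_num

theorem liftConst_sq (k n : ℕ) (α₀ : ℝ) :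
    liftConst k n α₀ ^ 2 = 2 * (2 ^ 20) ^ k * 256 ^ n * (1 / Real.sin α₀ ^ n) ^ 2 *
      (256 ^ n * (2 ^ 24) ^ k / 1024 * (1 / Real.sin α₀ ^ n) ^ 2 + 1) := by
  have e1 : ((2 : ℝ) ^ (10 * (k : ℝ) + 4 * (n : ℝ) + 1 / 2)) ^ 2 =
      2 * (2 ^ 20) ^ k * 256 ^ n := by
    rw [← Real.rpow_natCast, ← Real.rpow_mul (by norm_num), show
      (10 * (k : ℝ) + 4 * (n : ℝ) + 1 / 2) * ((2 : ℕ) : ℝ) = ((20 * k + 8 * n + 1 : ℕ) : ℝ) by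
        push_cast; ring, Real.rpow_natCast, pow_add, pow_add, pow_mul, pow_mul]
    norm_num
    ring
  have e2 : ((2 : ℝ) ^ (4 * (n : ℝ) + 12 * (k : ℝ) - 5)) ^ 2 =
      256 ^ n * (2 ^ 24) ^ k / 1024 := by
    rw [← Real.rpow_natCast, ← Real.rpow_mul (by norm_num), show
      (4 * (n : ℝ) + 12 * (k : ℝ) - 5) * ((2 : ℕ) : ℝ) =
        ((8 * n + 24 * k : ℕ) : ℝ) - ((10 : ℕ) : ℝ) by
        push_cast; ring, Real.rpow_sub (by norm_num), Real.rpow_natCast, Real.rpow_natCast,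
      pow_add, pow_mul, pow_mul]
    norm_num
  rw [liftConst, mul_pow, Real.sq_sqrt (by positivity), div_pow, div_pow, e1, e2]
  ring

/-- For `k = 0` only `t ^ 2` occurs on the left and for `k ≥ 1` only `t ^ 3`; as `t ≥ 1`, both are
absorbed by the `t ^ 4` term of `liftConst ^ 2`. -/
theorem liftBound_le (d n k : ℕ) (hd : d = 2 ∨ d = 3) (hn : d ≤ n) {α₀ : ℝ}
    (hsin : 0 < Real.sin α₀) :
    liftBound d n k (9 / Real.sin α₀) ≤ liftConst k n α₀ ^ 2 := by
  set t := 1 / Real.sin α₀ ^ n with ht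
  have ht1 : 1 ≤ t := by
    rw [ht, one_le_div (by positivity)]
    exact pow_le_one₀ hsin.le (Real.sin_le_one _)
  have hWn : (9 / Real.sin α₀) ^ n = 9 ^ n * t := by rw [div_pow, ht]; ring
  have hW2 : (9 / Real.sin α₀) ^ (2 * n) = 81 ^ n * t ^ 2 := by
    rw [mul_comm 2 n, pow_mul, hWn, mul_pow, ← pow_mul, mul_comm n 2, pow_mul]; norm_num
  have hA : ∀ j : ℕ, dilationConst j 2 ^ 2 ≤ 144 ^ j := fun j => by
    calc dilationConst j 2 ^ 2 ≤ (12 ^ j) ^ 2 :=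
          pow_le_pow_left₀ (dilationConst_nonneg _ _ le_rfl) (dilationConst_two_le j) 2
      _ = 144 ^ j := by rw [← pow_mul, mul_comm, pow_mul]; norm_num
  have hB : dilationConst k 16 ^ 2 ≤ 256 / 225 * (144 ^ k * 144 ^ k) := by
    calc dilationConst k 16 ^ 2 ≤ (16 / 15 * 144 ^ k) ^ 2 :=
          pow_le_pow_left₀ (dilationConst_nonneg _ _ (by norm_num)) (dilationConst_sixteen_le k) 2
      _ = _ := by ring
  rw [liftConst_sq, ← ht, liftBound, hW2, hWn]
  rcases k with _ | l
  · rw [if_pos rfl]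
    have h1 : 81 ^ n * t ^ 2 * (2 ^ n * (2 ^ (d - 1) * dilationConst 0 2 ^ 2)) *
        (2 ^ n * (16 ^ (d - 1) * dilationConst 0 16 ^ 2)) * 1 ≤
        81 ^ n * t ^ 2 * (2 ^ n * (2 ^ (d - 1) * 144 ^ 0)) *
        (2 ^ n * (16 ^ (d - 1) * (256 / 225 * (144 ^ 0 * 144 ^ 0)))) * 1 := by
      gcongr
      exact hA 0
    refine h1.trans ?_
    -- The base `324 = 81 · 2 · 2` is far below `256 ^ 2`, so it suffices to check `n = d`.
    have h2 : (324 : ℝ) ^ n * 32 ^ (d - 1) * (256 / 225) ≤ 2 * 256 ^ n * (256 ^ n / 1024) := by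
      rcases hd with rfl | rfl
      · obtain ⟨m, rfl⟩ := Nat.exists_eq_add_of_le hn
        have : (324 : ℝ) ^ m ≤ (256 * 256) ^ m := by gcongr; norm_num
        rw [mul_pow] at this
        rw [pow_add, pow_add]
        have h0 : (0 : ℝ) ≤ 324 ^ m := by positivity
        norm_num at this ⊢
        linarith
      · obtain ⟨m, rfl⟩ := Nat.exists_eq_add_of_le hn
        have : (324 : ℝ) ^ m ≤ (256 * 256) ^ m := by gcongr; norm_num
        rw [mul_pow] at this
        rw [pow_add, pow_add]
        have h0 : (0 : ℝ) ≤ 324 ^ m := by positivity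
        norm_num at this ⊢
        linarith
    have h3 : (256 : ℝ) ^ n / 1024 ≤ 256 ^ n * (2 ^ 24) ^ 0 / 1024 * t ^ 2 + 1 := by
      have : (1 : ℝ) ≤ t ^ 2 := one_le_pow₀ ht1
      have h4 : (0 : ℝ) ≤ 256 ^ n / 1024 := by positivity
      rw [pow_zero, mul_one]
      nlinarith
    calc _ = t ^ 2 * (((81 * 2 * 2) ^ n) * ((2 * 16) ^ (d - 1)) * (256 / 225)) := by
          simp only [mul_pow]; ring
      _ = t ^ 2 * (324 ^ n * 32 ^ (d - 1) * (256 / 225)) := by norm_num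
      _ ≤ t ^ 2 * (2 * 256 ^ n * (256 ^ n / 1024)) := by gcongr
      _ ≤ t ^ 2 * (2 * 256 ^ n * (256 ^ n * (2 ^ 24) ^ 0 / 1024 * t ^ 2 + 1)) := by gcongr
      _ = _ := by ring
  · rw [if_neg (Nat.succ_ne_zero l), Nat.add_sub_cancel]
    have hd3 : d ≤ 3 := by omega
    have hn2 : 2 ≤ n := by omega
    have hl : ((l + 1 : ℕ) : ℝ) ≤ 2 ^ l := by exact_mod_cast Nat.lt_two_pow_self
    have ht0 : 0 ≤ t := by linarith
    have hp8 : (2 : ℝ) ^ d ≤ 8 := by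
      calc (2 : ℝ) ^ d ≤ 2 ^ 3 := pow_le_pow_right₀ (by norm_num) hd3
        _ = 8 := by norm_num
    have h32 : (2 : ℝ) ^ (d - 1) * 16 ^ (d - 1) ≤ 1024 := by
      rw [← mul_pow]
      calc ((2 : ℝ) * 16) ^ (d - 1) ≤ (2 * 16) ^ 2 := pow_le_pow_right₀ (by norm_num) (by omega)
        _ = 1024 := by norm_num
    have hR : 2 * (1 + 9 ^ n * t * (2 ^ d * ((l + 1 : ℕ) : ℝ) * dilationConst l 2 ^ 2 *
        4 ^ (n + 1))) ≤ 66 * 36 ^ n * 288 ^ l * t := by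
      have h1 : 9 ^ n * t * (2 ^ d * ((l + 1 : ℕ) : ℝ) * dilationConst l 2 ^ 2 * 4 ^ (n + 1)) ≤
          9 ^ n * t * (8 * 2 ^ l * 144 ^ l * 4 ^ (n + 1)) := by
        gcongr
        exact hA l
      have h2 : 9 ^ n * t * (8 * 2 ^ l * 144 ^ l * 4 ^ (n + 1)) =
          32 * (36 ^ n * 288 ^ l * t) := by
        rw [show (36 : ℝ) = 9 * 4 by norm_num, show (288 : ℝ) = 2 * 144 by norm_num, mul_pow,
          mul_pow]
        ring
      have h3 : 1 ≤ 36 ^ n * 288 ^ l * t := by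
        have a1 : (1 : ℝ) ≤ 36 ^ n := one_le_pow₀ (by norm_num)
        have a2 : (1 : ℝ) ≤ 288 ^ l := one_le_pow₀ (by norm_num)
        exact one_le_mul_of_one_le_of_one_le (one_le_mul_of_one_le_of_one_le a1 a2) ht1
      linarith
    -- Here `11664 = 81 · 2 · 2 · 36`, `859963392 = 144³ · 288` and `2985984 = 144³`; on the right
    -- `2 ^ 35 = 2 · 2 ^ 20 · 2 ^ 24 / 1024`. The worst case is `n = 2`, `l = 0`.
    have hnum : (11664 : ℝ) ^ n * 859963392 ^ l * (1024 * (256 / 225) * 2985984 * 66) ≤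
        65536 ^ n * (2 ^ 44) ^ l * 2 ^ 35 := by
      obtain ⟨m, rfl⟩ := Nat.exists_eq_add_of_le hn2
      have h1 : (11664 : ℝ) ^ m * 859963392 ^ l ≤ 65536 ^ m * (2 ^ 44) ^ l := by
        gcongr <;> norm_num
      calc (11664 : ℝ) ^ (2 + m) * 859963392 ^ l * (1024 * (256 / 225) * 2985984 * 66)
          = (11664 ^ m * 859963392 ^ l) *
            (11664 ^ 2 * (1024 * (256 / 225) * 2985984 * 66)) := by ring
        _ ≤ (11664 ^ m * 859963392 ^ l) * (65536 ^ 2 * 2 ^ 35) :=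
          mul_le_mul_of_nonneg_left (by norm_num) (by positivity)
        _ ≤ (65536 ^ m * (2 ^ 44) ^ l) * (65536 ^ 2 * 2 ^ 35) := by gcongr
        _ = _ := by ring
    have h1 : 81 ^ n * t ^ 2 * (2 ^ n * (2 ^ (d - 1) * dilationConst (l + 1) 2 ^ 2)) *
        (2 ^ n * (16 ^ (d - 1) * dilationConst (l + 1) 16 ^ 2)) *
        (2 * (1 + 9 ^ n * t * (2 ^ d * ((l + 1 : ℕ) : ℝ) * dilationConst l 2 ^ 2 *
          4 ^ (n + 1)))) ≤
        81 ^ n * t ^ 2 * (2 ^ n * (2 ^ (d - 1) * 144 ^ (l + 1))) *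
        (2 ^ n * (16 ^ (d - 1) * (256 / 225 * (144 ^ (l + 1) * 144 ^ (l + 1))))) *
        (66 * 36 ^ n * 288 ^ l * t) := by
      gcongr
      exact hA (l + 1)
    refine h1.trans ?_
    have h2 : 81 ^ n * t ^ 2 * (2 ^ n * (2 ^ (d - 1) * 144 ^ (l + 1))) *
        (2 ^ n * (16 ^ (d - 1) * (256 / 225 * (144 ^ (l + 1) * 144 ^ (l + 1))))) *
        (66 * 36 ^ n * 288 ^ l * t) =
        (2 ^ (d - 1) * 16 ^ (d - 1)) * (t ^ 2 * t * ((81 * 2 * 2 * 36) ^ n *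
          (144 * 144 * 144 * 288) ^ l * (256 / 225 * 2985984 * 66))) := by
      simp only [mul_pow, pow_succ]
      ring
    rw [h2]
    calc _ ≤ 1024 * (t ^ 2 * t * ((81 * 2 * 2 * 36) ^ n *
          (144 * 144 * 144 * 288) ^ l * (256 / 225 * 2985984 * 66))) := by gcongr
      _ = t ^ 2 * t * (11664 ^ n * 859963392 ^ l * (1024 * (256 / 225) * 2985984 * 66)) := by
        norm_num; ring
      _ ≤ t ^ 2 * t * (65536 ^ n * (2 ^ 44) ^ l * 2 ^ 35) := by gcongr
      _ ≤ t ^ 2 * t ^ 2 * (65536 ^ n * (2 ^ 44) ^ l * 2 ^ 35) := by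
        gcongr
        exact le_self_pow₀ ht1 (by norm_num)
      _ = 2 * (2 ^ 20) ^ (l + 1) * 256 ^ n * t ^ 2 *
          (256 ^ n * (2 ^ 24) ^ (l + 1) / 1024 * t ^ 2) := by
        rw [show (65536 : ℝ) = 256 * 256 by norm_num,
          show ((2 : ℝ) ^ 44) = 2 ^ 20 * 2 ^ 24 by norm_num, mul_pow, mul_pow, pow_succ _ l,
          pow_succ _ l]
        ring
      _ ≤ _ := by gcongr; linarith

/-! ### Assembly of the theorem. -/

theorem lemma3p1 (d n k : ℕ) (hd : d = 2 ∨ d = 3) (T : ConvexPolytope d n) (α₀ : ℝ)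
    (hα₀ : 0 < α₀) (hsin : Real.sqrt d / 8 ≤ Real.sin α₀)
    (hangle : ∀ i, α₀ ≤ T.normalAngle i)
    (hangle_nbr : ∀ i, T.IsNeighbor i → T.normalAngle i ≤ Real.pi - α₀)
    (hlength : ∀ i, T.IsNeighbor i →
      T.size / 4 ≤ 2 * Metric.infDist T.barycenter (T.facet 0 ∩ T.facet i.succ)) :
    (∀ i, ∃! l : MvPolynomial (Fin d) ℝ, T.IsFaceFactor i l) ∧
    ∀ lam : Fin n → MvPolynomial (Fin d) ℝ, (∀ i, T.IsFaceFactor i (lam i)) →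
      ∀ q₀ : MvPolynomial (Fin d) ℝ, q₀.totalDegree ≤ k →
        (∃! q, T.IsLift k lam q₀ q) ∧
        ∀ q, T.IsLift k lam q₀ q →
          l2Norm T.bulk q ≤ liftConst k n α₀ * Real.sqrt T.size * l2Norm T.surface q₀ := by
  have hd2 : 2 ≤ d := by omega
  have hd3 : d ≤ 3 := by omega
  have hdn := T.dim_le
  have hs : 0 < Real.sin α₀ := by
    refine lt_of_lt_of_le ?_ hsin
    have : (0 : ℝ) < d := by exact_mod_cast (by omega : 0 < d)
    positivity
  have hball := T.closedBall_subset_footprint (T.ball_subset_footprint hd2 hlength)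
  have hW : ∀ x ∈ T.carrier, ∀ i : Fin n,
      T.gap i.succ x ≤ 9 / Real.sin α₀ * T.gap i.succ T.barycenter := fun x hx i =>
    T.gap_le_of_mem_carrier hball hα₀ hs (hangle i) hx
  refine ⟨T.existsUnique_isFaceFactor, fun lam hlam q₀ hq₀ => ?_⟩
  -- The data `r₀` is kept free: `q₀` gives the norm bound, and `0` gives uniqueness.
  have hbound : ∀ (r₀ q₁ : MvPolynomial (Fin d) ℝ), q₁.totalDegree ≤ k →
      (∫ x, T.weight x * (polyVal q₁ x * polyVal q₁ x) ∂T.surface =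
        ∫ x, polyVal r₀ x * polyVal q₁ x ∂T.surface) →
      (∀ p : MvPolynomial (Fin d) ℝ, p.totalDegree + 1 ≤ k →
        ∫ x, T.weight x * (polyVal q₁ x * polyVal p x) ∂T.bulk = 0) →
      ∫ x, polyVal ((∏ i, lam i) * q₁) x ^ 2 ∂T.bulk ≤
        liftConst k n α₀ ^ 2 * T.size * ∫ x, polyVal r₀ x ^ 2 ∂T.surface := by
    intro r₀ q₁ hq₁ h1 h2
    simp only [← sq] at h1
    have h3 := T.integral_sq_lift_le hd3 hball (by positivity) hW hq₁ h1 h2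
    simp only [polyVal_mul, T.polyVal_prod_faceFactor hlam]
    refine h3.trans ?_
    have h4 := liftBound_le d n k hd hdn hs
    have h5 := T.size_pos
    have h6 : 0 ≤ ∫ x, polyVal r₀ x ^ 2 ∂T.surface := integral_nonneg fun x => sq_nonneg _
    rw [mul_comm T.size]
    gcongr
  have hlift : ∀ q, T.IsLift k lam q₀ q → ∃ q₁ : MvPolynomial (Fin d) ℝ, q₁.totalDegree ≤ k ∧
      q = (∏ i, lam i) * q₁ ∧
      (∀ p : MvPolynomial (Fin d) ℝ, p.totalDegree ≤ k →
        ∫ x, T.weight x * (polyVal q₁ x * polyVal p x) ∂T.surface =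
          ∫ x, polyVal q₀ x * polyVal p x ∂T.surface) ∧
      ∀ p : MvPolynomial (Fin d) ℝ, p.totalDegree + 1 ≤ k →
        ∫ x, T.weight x * (polyVal q₁ x * polyVal p x) ∂T.bulk = 0 := by
    rintro q ⟨-, ⟨q₁, hq₁, rfl⟩, h1, h2⟩
    refine ⟨q₁, hq₁, rfl, fun p hp => ?_, fun p hp => ?_⟩
    · have h3 := h1 p hp
      simp only [l2Inner, polyVal_sub, polyVal_mul, T.polyVal_prod_faceFactor hlam] at h3
      have hq₁c := continuous_polyVal q₁
      have hq₀c := continuous_polyVal q₀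
      have hpc := continuous_polyVal p
      have i1 : Integrable (fun x => T.weight x * (polyVal q₁ x * polyVal p x)) T.surface :=
        T.integrable_surface (T.continuous_weight.mul (hq₁c.mul hpc))
      have i2 : Integrable (fun x => polyVal q₀ x * polyVal p x) T.surface :=
        T.integrable_surface (hq₀c.mul hpc)
      rw [← sub_eq_zero, ← integral_sub i1 i2, ← h3]
      exact integral_congr_ae (Filter.Eventually.of_forall fun x => by simp only []; ring)
    · have h3 := h2 p hp
      simp only [l2Inner, polyVal_mul, T.polyVal_prod_faceFactor hlam, mul_assoc] at h3
      exact h3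
  refine ⟨?_, fun q hq => ?_⟩
  · obtain ⟨q₁, hq₁, h1, h2⟩ := T.exists_lift_factor hd3 k q₀
    refine ⟨(∏ i, lam i) * q₁, ⟨?_, ⟨q₁, hq₁, rfl⟩, fun p hp => ?_, fun p hp => ?_⟩, fun q' hq' => ?_⟩
    · refine (MvPolynomial.totalDegree_mul _ _).trans ?_
      have : (∏ i, lam i).totalDegree ≤ n := by
        refine (MvPolynomial.totalDegree_finsetProd _ _).trans ?_
        refine (Finset.sum_le_sum fun i _ => (hlam i).1).trans ?_
        simp
      omega
    · have h3 := h1 p hp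
      have hq₁c := continuous_polyVal q₁
      have hq₀c := continuous_polyVal q₀
      have hpc := continuous_polyVal p
      have i1 : Integrable (fun x => T.weight x * (polyVal q₁ x * polyVal p x)) T.surface :=
        T.integrable_surface (T.continuous_weight.mul (hq₁c.mul hpc))
      have i2 : Integrable (fun x => polyVal q₀ x * polyVal p x) T.surface :=
        T.integrable_surface (hq₀c.mul hpc)
      rw [← sub_eq_zero, ← integral_sub i1 i2] at h3
      rw [← h3]
      simp only [l2Inner, polyVal_sub, polyVal_mul, T.polyVal_prod_faceFactor hlam]
      exact integral_congr_ae (Filter.Eventually.of_forall fun x => by simp only []; ring)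
    · have h3 := h2 p hp
      simp only [l2Inner, polyVal_mul, T.polyVal_prod_faceFactor hlam, mul_assoc]
      exact h3
    · obtain ⟨r, hr, rfl, h1', h2'⟩ := hlift q' hq'
      rw [← sub_eq_zero, ← mul_sub]
      have hrc := continuous_polyVal r
      have hqc := continuous_polyVal q₁
      have hwc := T.continuous_weight
      have hdiff : ∀ (μ : Measure (EuclideanSpace ℝ (Fin d)))
          (_ : ∀ f : EuclideanSpace ℝ (Fin d) → ℝ, Continuous f → Integrable f μ)
          (p : MvPolynomial (Fin d) ℝ),
          ∫ x, T.weight x * (polyVal (r - q₁) x * polyVal p x) ∂μ =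
            ∫ x, T.weight x * (polyVal r x * polyVal p x) ∂μ -
            ∫ x, T.weight x * (polyVal q₁ x * polyVal p x) ∂μ := by
        intro μ hμ p
        have hpc := continuous_polyVal p
        have i1 : Integrable (fun x => T.weight x * (polyVal r x * polyVal p x)) μ :=
          hμ _ (hwc.mul (hrc.mul hpc))
        have i2 : Integrable (fun x => T.weight x * (polyVal q₁ x * polyVal p x)) μ :=
          hμ _ (hwc.mul (hqc.mul hpc))
        rw [← integral_sub i1 i2]
        exact integral_congr_ae (Filter.Eventually.of_forall fun x => by
          simp only [polyVal_sub]; ring)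
      have hdeg : (r - q₁).totalDegree ≤ k :=
        (MvPolynomial.totalDegree_sub _ _).trans (max_le hr hq₁)
      refine T.eq_zero_of_integral_sq_le_zero ?_
      -- The difference of two liftings satisfies the conditions with zero data, so its norm on `T`
      -- vanishes; as `T` has interior points, the polynomial itself is zero.
      have h3 := hbound 0 (r - q₁) hdeg
        (by rw [hdiff _ (fun f hf => T.integrable_surface hf), h1' _ hdeg, h1 _ hdeg, sub_self]
            simp)
        (fun p hp => by
          rw [hdiff _ (fun f hf => T.integrable_bulk hf), h2' p hp, h2 p hp, sub_self])
      simpa using h3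
  · obtain ⟨q₁, hq₁, rfl, h1, h2⟩ := hlift q hq
    have h3 := hbound q₀ q₁ hq₁ (h1 q₁ hq₁) h2
    have hC : 0 ≤ liftConst k n α₀ := by
      have : 0 ≤ Real.sin α₀ ^ n := by positivity
      unfold liftConst
      positivity
    simp only [l2Norm, l2Inner, ← sq]
    rw [← Real.sqrt_sq hC, ← Real.sqrt_mul (sq_nonneg _), ← Real.sqrt_mul (mul_nonneg
      (sq_nonneg _) T.size_pos.le)]
    exact Real.sqrt_le_sqrt h3
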